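/- Let $M$ be a smooth ($\sigma$-compact, Hausdorff) manifold of dimension $n$ and let $E\to M$ be an exact Courant algebroid with pairing $\langle\cdot,\cdot\rangle$, anchor $\rho\colon E\to TM$ and Dorfman bracket $[\cdot,\cdot]$; exactness means that $0\to T^*M\xrightarrow{\rho^*}E\xrightarrow{\rho}TM\to0$ is exact, where $\langle\rho^*\xi,e\rangle=\xi(\rho(e))$. Let $V\subset E$ be a generalized metric, i.e. a positive definite subbundle of rank $n$, and let $D\subset E$ be a (regular) small Dirac structure, i.e. an isotropic subbundle with $[\Gamma(D),\Gamma(D)]\subset\Gamma(D)$. The triple $(E,V,D)$ is called a Dirac-Riemannian foliation if $W:=V_D:=D\oplus(D^\perp\cap V)$ is a $D$-transverse generalized metric, i.e. $W$ is a subbundle of $E$ of rank $n$ with $D\subset W\subset D^\perp$, $\langle w,w\rangle>0$ for every $w\in W\setminus D$, and $[\Gamma(D),\Gamma(W)]\subset\Gamma(W)$. Let $s\colon TM\to E$ be the unique isotropic splitting of $\rho$ for which $V$ is the graph of a Riemannian metric $g$, $V=\{s(u)+\rho^*(g(u,\cdot)) : u\in TM\}$, and let $H(X,Y,Z)=\langle[s(X),s(Y)],s(Z)\rangle$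 be the corresponding closed $3$-form. In the resulting identification $E\cong TM\oplus T^*M$, the inclusion of $D$ has components $\rho_D=\rho|_D\in\Gamma(D^*\otimes TM)$ and $\alpha_D\in\Gamma(D^*\otimes T^*M)$, so that $e=s(\rho_D(e))+\rho^*(\alpha_D(e))$ for $e\in D$. Put $\overline\rho_D:=\iota_{\rho_D}g\in\Gamma(D^*\otimes T^*M)$, i.e. $\overline\rho_D(e)=g(\rho_D(e),\cdot)$. **Theorem.** $(E,V,D)$ is a Dirac-Riemannian foliation if and only if there exist connections $\nabla^\pm=\nabla\pm\phi$ on the vector bundle $D$, with $\nabla$ a connection on $D$ and $\phi\in\Omega^1(M,\mathrm{End}(D))$, such that $$\mathrm{Sym}\bigl(\overline\nabla\,\overline\rho_D-\phi^*(\alpha_D)\bigr)=0,\tag{1}$$ $$\mathrm{Alt}\bigl(\overline\nabla\alpha_D-\phi^*(\overline\rho_D)-\tfrac12\iota_{\rho_D}H\bigr)=0.\tag{2}$$ Here $\overline\nabla$ is the connection on $D^*\otimes T^*M$ induced by $\nabla$ and the Levi-Civita connection of $g$, $\phi^*\in\Omega^1(M,\mathrm{End}(D^*))$ is the dual of $\phi$,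 so $(\phi^*_u\beta)(e)=\beta(\phi_u e)$, the expressions in parentheses are regarded as sections of $D^*\otimes T^*M\otimes T^*M$ whose first $T^*M$-slot is the direction of $\overline\nabla$, respectively of $\phi^*$ (and $(\iota_{\rho_D}H)(e)(u,v)=H(\rho_D(e),u,v)$), and $\mathrm{Sym}$, $\mathrm{Alt}$ are the symmetrization and antisymmetrization projections of $T^*M\otimes T^*M$. -/

import Mathlib

set_option linter.unusedSectionVars false

open Bundle Set Filter Topology Module
open scoped Manifold ContDiff

namespace DiracRiemann

noncomputable section

section Bundles

variable {n : ℕ} {M : Type*} [TopologicalSpace M] [ChartedSpace (EuclideanSpace ℝ (Fin n)) M]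

variable (n M) in
/-- Smooth vector fields on `M`. -/
abbrev VF [IsManifold (𝓡 n) ∞ M] :=
  ContMDiffSection (𝓡 n) (EuclideanSpace ℝ (Fin n)) ∞ (TangentSpace (𝓡 n) : M → Type)

/-- The derivative `X f` of a function along a vector field. -/
def lieDer (X : ∀ x : M, TangentSpace (𝓡 n) x) (f : M → ℝ) (x : M) : ℝ :=
  mvfderiv (𝓡 n) f x (X x)

variable {F : Type*} [NormedAddCommGroup F] [NormedSpace ℝ F]
  {E : M → Type*} [∀ x, AddCommGroup (E x)] [∀ x, Module ℝ (E x)]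
  [∀ x, TopologicalSpace (E x)] [TopologicalSpace (TotalSpace F E)] [FiberBundle F E]
  [VectorBundle ℝ F E]

variable (n F E) in
/-- Smooth sections of the vector bundle `E`. -/
abbrev Sec := ContMDiffSection (𝓡 n) F ∞ E

instance : SMul C^∞⟮𝓡 n, M; ℝ⟯ (Sec n F E) :=
  ⟨fun f s => ⟨fun x => f x • s x, f.contMDiff.smul_section s.contMDiff⟩⟩

@[simp] theorem smul_sec_apply (f : C^∞⟮𝓡 n, M; ℝ⟯) (s : Sec n F E) (x : M) :
    (f • s) x = f x • s x := rfl

/-- `Γ(E)` is a module over `C^∞(M)`. -/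
instance : Module C^∞⟮𝓡 n, M; ℝ⟯ (Sec n F E) where
  one_smul s := by ext x; exact one_smul ℝ (s x)
  mul_smul f g s := by ext x; exact mul_smul (f x) (g x) (s x)
  smul_zero f := by ext x; exact smul_zero (f x)
  smul_add f s t := by ext x; exact smul_add (f x) (s x) (t x)
  add_smul f g s := by ext x; exact add_smul (f x) (g x) (s x)
  zero_smul s := by ext x; exact zero_smul ℝ (s x)

variable (n F) in
/-- A family of subspaces of the fibres of `E` is a smooth subbundle if it has smooth local
frames. -/
def IsSubbundle (W : ∀ x, Submodule ℝ (E x)) : Prop :=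
  ∀ x₀ : M, ∃ U : Set M, IsOpen U ∧ x₀ ∈ U ∧ ∃ (k : ℕ) (s : Fin k → ∀ x, E x),
    (∀ i, ContMDiffOn (𝓡 n) ((𝓡 n).prod 𝓘(ℝ, F)) ∞ (fun x => TotalSpace.mk' F x (s i x)) U) ∧
    ∀ x ∈ U, LinearIndependent ℝ (fun i => s i x) ∧
      Submodule.span ℝ (range fun i => s i x) = W x

variable (n F) in
/-- The `C^∞(M)`-module `Γ(W)` of smooth sections of `E` with values in `W`. -/
def secs (W : ∀ x, Submodule ℝ (E x)) : Submodule C^∞⟮𝓡 n, M; ℝ⟯ (Sec n F E) where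
  carrier := {s | ∀ x, s x ∈ W x}
  add_mem' hs ht x := (W x).add_mem (hs x) (ht x)
  zero_mem' x := (W x).zero_mem
  smul_mem' f _ hs x := (W x).smul_mem (f x) (hs x)

end Bundles

section Smoothness

variable {n : ℕ} {M : Type*} [TopologicalSpace M] [ChartedSpace (EuclideanSpace ℝ (Fin n)) M]
  {F₁ : Type*} [NormedAddCommGroup F₁] [NormedSpace ℝ F₁] [FiniteDimensional ℝ F₁]
  {E₁ : M → Type*} [∀ x, AddCommGroup (E₁ x)] [∀ x, Module ℝ (E₁ x)]
  [∀ x, TopologicalSpace (E₁ x)] [TopologicalSpace (TotalSpace F₁ E₁)] [FiberBundle F₁ E₁]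
  [VectorBundle ℝ F₁ E₁] 
  {F₂ : Type*} [NormedAddCommGroup F₂] [NormedSpace ℝ F₂]
  {E₂ : M → Type*} [∀ x, AddCommGroup (E₂ x)] [∀ x, Module ℝ (E₂ x)]
  [∀ x, TopologicalSpace (E₂ x)] [∀ x, IsTopologicalAddGroup (E₂ x)]
  [∀ x, ContinuousSMul ℝ (E₂ x)] [TopologicalSpace (TotalSpace F₂ E₂)] [FiberBundle F₂ E₂]
  [VectorBundle ℝ F₂ E₂]

theorem contMDiffAt_clm_of_apply {f : M → F₁ →L[ℝ] F₂} {x₀ : M}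
    (h : ∀ v, ContMDiffAt (𝓡 n) 𝓘(ℝ, F₂) ∞ (fun x => f x v) x₀) :
    ContMDiffAt (𝓡 n) 𝓘(ℝ, F₁ →L[ℝ] F₂) ∞ f x₀ := by
  let b := Module.finBasis ℝ F₁
  have hf : f = fun x => ∑ i, ContinuousLinearMap.smulRightL ℝ F₁ F₂
      (LinearMap.toContinuousLinearMap (b.coord i)) (f x (b i)) := by
    funext x
    ext v
    conv_lhs => rw [← b.sum_repr v]
    simp [-Basis.sum_repr, _root_.map_sum]
  rw [hf]
  refine ContMDiffAt.sum fun i _ => ?_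
  exact (ContinuousLinearMap.contMDiff _).contMDiffAt.comp x₀ (h (b i))

/-- A family of fibrewise linear maps is smooth if it maps smooth sections to smooth sections. -/
theorem contMDiffAt_hom_of_apply {ϕ : ∀ x, E₁ x →L[ℝ] E₂ x} {x₀ : M}
    (h : ∀ v : ∀ x, E₁ x,
      ContMDiffAt (𝓡 n) ((𝓡 n).prod 𝓘(ℝ, F₁)) ∞ (fun x => TotalSpace.mk' F₁ x (v x)) x₀ →
      ContMDiffAt (𝓡 n) ((𝓡 n).prod 𝓘(ℝ, F₂)) ∞ (fun x => TotalSpace.mk' F₂ x (ϕ x (v x))) x₀) :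
    ContMDiffAt (𝓡 n) ((𝓡 n).prod 𝓘(ℝ, F₁ →L[ℝ] F₂)) ∞
      (fun x => TotalSpace.mk' (F₁ →L[ℝ] F₂) x (ϕ x)) x₀ := by
  rw [contMDiffAt_hom_bundle]
  refine ⟨contMDiffAt_id, contMDiffAt_clm_of_apply fun v => ?_⟩
  have hmem := mem_baseSet_trivializationAt F₁ E₁ x₀
  have key := h (fun x => (trivializationAt F₁ E₁ x₀).symm x v) (by
    rw [contMDiffAt_section]
    refine (contMDiffAt_const (c := v)).congr_of_eventuallyEq ?_
    filter_upwards [(trivializationAt F₁ E₁ x₀).open_baseSet.mem_nhds hmem] with x hx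
    rw [Trivialization.apply_mk_symm _ hx])
  rw [contMDiffAt_section] at key
  refine key.congr_of_eventuallyEq ?_
  filter_upwards [(trivializationAt F₁ E₁ x₀).open_baseSet.mem_nhds hmem,
    (trivializationAt F₂ E₂ x₀).open_baseSet.mem_nhds (mem_baseSet_trivializationAt F₂ E₂ x₀)]
    with x hx hx'
  simp [ContinuousLinearMap.inCoordinates, Trivialization.symmL_apply _ hx,
    Trivialization.coe_linearMapAt_of_mem _ hx']

/-- If `ϕ` is a smooth family of fibrewise linear maps, invertible at `x₀`, and `ϕ v` is smooth
at `x₀`, then so is `v`. -/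
theorem contMDiffAt_of_hom_apply {ϕ : ∀ x, E₁ x →L[ℝ] E₂ x} {x₀ : M}
    (hϕ : ContMDiffAt (𝓡 n) ((𝓡 n).prod 𝓘(ℝ, F₁ →L[ℝ] F₂)) ∞
      (fun x => TotalSpace.mk' (F₁ →L[ℝ] F₂) x (ϕ x)) x₀)
    (hb : Function.Bijective (ϕ x₀)) {v : ∀ x, E₁ x}
    (hv : ContMDiffAt (𝓡 n) ((𝓡 n).prod 𝓘(ℝ, F₂)) ∞
      (fun x => TotalSpace.mk' F₂ x (ϕ x (v x))) x₀) :
    ContMDiffAt (𝓡 n) ((𝓡 n).prod 𝓘(ℝ, F₁)) ∞ (fun x => TotalSpace.mk' F₁ x (v x)) x₀ := by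
  rw [contMDiffAt_hom_bundle] at hϕ
  rw [contMDiffAt_section] at hv ⊢
  set A : M → F₁ →L[ℝ] F₂ := fun x =>
    ContinuousLinearMap.inCoordinates F₁ E₁ F₂ E₂ x₀ x x₀ x (ϕ x) with hA
  have hA1 : ContMDiffAt (𝓡 n) 𝓘(ℝ, F₁ →L[ℝ] F₂) ∞ A x₀ := hϕ.2
  have hmem := mem_baseSet_trivializationAt F₁ E₁ x₀
  have hmem2 := mem_baseSet_trivializationAt F₂ E₂ x₀
  have hAb : Function.Bijective (A x₀) := by
    have : A x₀ = ((trivializationAt F₂ E₂ x₀).continuousLinearEquivAt ℝ x₀ hmem2 :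
        E₂ x₀ →L[ℝ] F₂) ∘L ϕ x₀ ∘L
        (((trivializationAt F₁ E₁ x₀).continuousLinearEquivAt ℝ x₀ hmem).symm :
          F₁ →L[ℝ] E₁ x₀) := ContinuousLinearMap.inCoordinates_eq hmem hmem2
    rw [this]
    exact ((trivializationAt F₂ E₂ x₀).continuousLinearEquivAt ℝ x₀ hmem2).bijective.comp
      (hb.comp ((trivializationAt F₁ E₁ x₀).continuousLinearEquivAt ℝ x₀ hmem).symm.bijective)
  have hAi : (A x₀).IsInvertible :=
    ⟨(LinearEquiv.ofBijective (A x₀ : F₁ →ₗ[ℝ] F₂) hAb).toContinuousLinearEquiv, by ext; rfl⟩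
  have hinv : ContMDiffAt (𝓡 n) 𝓘(ℝ, F₂ →L[ℝ] F₁) ∞
      (fun x => ContinuousLinearMap.inverse (A x)) x₀ :=
    (hAi.contDiffAt_map_inverse (n := ∞)).contMDiffAt.comp x₀ hA1
  refine (hinv.clm_apply hv).congr_of_eventuallyEq ?_
  have hev : ∀ᶠ x in 𝓝 x₀, (A x).IsInvertible :=
    by
    obtain ⟨e, he⟩ := hAi
    have := hA1.continuousAt.eventually (he ▸ ContinuousLinearEquiv.nhds e)
    filter_upwards [this] with x hx using hx
  filter_upwards [(trivializationAt F₁ E₁ x₀).open_baseSet.mem_nhds hmem,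
    (trivializationAt F₂ E₂ x₀).open_baseSet.mem_nhds hmem2, hev] with x hx hx' hxi
  obtain ⟨e, he⟩ := hxi
  have : (trivializationAt F₂ E₂ x₀ ⟨x, ϕ x (v x)⟩).2 =
      A x (trivializationAt F₁ E₁ x₀ ⟨x, v x⟩).2 := by
    simp only [hA, ContinuousLinearMap.inCoordinates_eq hx hx', ContinuousLinearMap.comp_apply,
      ContinuousLinearEquiv.coe_coe, Trivialization.continuousLinearEquivAt_apply]
    congr 4
    exact (((trivializationAt F₁ E₁ x₀).continuousLinearEquivAt ℝ x hx).symm_apply_apply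
      (v x)).symm
  rw [this, ← he]
  simp

end Smoothness

section Riesz

variable {W : Type*} [AddCommGroup W] [Module ℝ W] [TopologicalSpace W] [T2Space W]
  [IsTopologicalAddGroup W] [ContinuousSMul ℝ W] [FiniteDimensional ℝ W]

theorem bijective_of_nondegenerate (b : W →L[ℝ] W →L[ℝ] ℝ)
    (hb : ∀ v, (∀ w, b v w = 0) → v = 0) : Function.Bijective b := by
  have hinj : Function.Injective (b : W →ₗ[ℝ] W →L[ℝ] ℝ) := by
    rw [← LinearMap.ker_eq_bot, LinearMap.ker_eq_bot']
    intro v hv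
    exact hb v fun w => by
      have := congrArg (fun L : W →L[ℝ] ℝ => L w) hv
      simpa using this
  have hfr : finrank ℝ W = finrank ℝ (W →L[ℝ] ℝ) := by
    rw [← LinearEquiv.finrank_eq (LinearMap.toContinuousLinearMap (𝕜 := ℝ) (E := W) (F' := ℝ))]
    exact (Subspace.dual_finrank_eq (K := ℝ) (V := W)).symm
  have : FiniteDimensional ℝ (W →L[ℝ] ℝ) :=
    (LinearMap.toContinuousLinearMap (𝕜 := ℝ) (E := W) (F' := ℝ)).finiteDimensional
  exact ⟨hinj, (LinearMap.injective_iff_surjective_of_finrank_eq_finrank hfr).1 hinj⟩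

/-- The vector representing a linear form `L` through a nondegenerate bilinear form `b`:
`b (riesz b hb L) w = L w`. -/
def riesz (b : W →L[ℝ] W →L[ℝ] ℝ) (hb : ∀ v, (∀ w, b v w = 0) → v = 0) :
    (W →L[ℝ] ℝ) →ₗ[ℝ] W :=
  (LinearEquiv.ofBijective (b : W →ₗ[ℝ] W →L[ℝ] ℝ) (bijective_of_nondegenerate b hb)).symm

@[simp] theorem apply_riesz (b : W →L[ℝ] W →L[ℝ] ℝ) (hb : ∀ v, (∀ w, b v w = 0) → v = 0)
    (L : W →L[ℝ] ℝ) : b (riesz b hb L) = L :=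
  (LinearEquiv.ofBijective (b : W →ₗ[ℝ] W →L[ℝ] ℝ)
    (bijective_of_nondegenerate b hb)).apply_symm_apply L

theorem isVonNBounded_of_pos {W : Type*} [NormedAddCommGroup W] [NormedSpace ℝ W]
    [FiniteDimensional ℝ W] (b : W →L[ℝ] W →L[ℝ] ℝ) (hb : ∀ v, v ≠ 0 → 0 < b v v) :
    Bornology.IsVonNBounded ℝ {v : W | b v v < 1} := by
  rw [NormedSpace.isVonNBounded_iff]
  rcases subsingleton_or_nontrivial W with h | h
  · exact (Set.toFinite _).isBounded
  obtain ⟨w, hw, hmin⟩ := (isCompact_sphere (0 : W) 1).exists_isMinOn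
    (NormedSpace.sphere_nonempty.2 zero_le_one)
    (f := fun v => b v v) (b.continuous.clm_apply continuous_id).continuousOn
  have hw1 : ‖w‖ = 1 := by simpa using hw
  have hc : 0 < b w w := hb w (fun h => by simp [h] at hw1)
  refine isBounded_iff_forall_norm_le.2 ⟨1 + 1 / b w w, fun v hv => ?_⟩
  rcases eq_or_ne v 0 with rfl | hv0
  · simp; positivity
  have hv1 : 0 < ‖v‖ := norm_pos_iff.2 hv0
  have hs : ‖v‖⁻¹ • v ∈ Metric.sphere (0 : W) 1 := by simp [norm_smul, hv1.ne']
  have h1 : b w w ≤ b (‖v‖⁻¹ • v) (‖v‖⁻¹ • v) := hmin hs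
  simp only [map_smul, _root_.smul_apply, smul_eq_mul] at h1
  have h2 : b w w * ‖v‖ ^ 2 ≤ b v v := by
    calc b w w * ‖v‖ ^ 2 ≤ ‖v‖⁻¹ * (‖v‖⁻¹ * b v v) * ‖v‖ ^ 2 := by gcongr
      _ = b v v := by field_simp
  have h3 : b v v < 1 := hv
  have h4 : ‖v‖ ^ 2 < 1 / b w w := by rw [lt_div_iff₀ hc]; linarith
  nlinarith [sq_nonneg (‖v‖ - 1)]

end Riesz

section LeviCivita

variable {n : ℕ} {M : Type*} [TopologicalSpace M] [ChartedSpace (EuclideanSpace ℝ (Fin n)) M]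
  [IsManifold (𝓡 n) ∞ M]

variable (n M) in
/-- Smooth Riemannian metrics on `M`. -/
abbrev Metric := ContMDiffRiemannianMetric (𝓡 n) ∞ (EuclideanSpace ℝ (Fin n))
  (TangentSpace (𝓡 n) : M → Type)

/-- The Koszul expression, equal to `g (∇_X Y, Z)` for the Levi-Civita connection `∇` of `g`. -/
def koszul (g : Metric n M) (X Y Z : ∀ x : M, TangentSpace (𝓡 n) x) (x : M) : ℝ :=
  (1 / 2) * (lieDer X (fun y => g.inner y (Y y) (Z y)) x
    + lieDer Y (fun y => g.inner y (X y) (Z y)) x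
    - lieDer Z (fun y => g.inner y (X y) (Y y)) x
    + g.inner x (VectorField.mlieBracket (𝓡 n) X Y x) (Z x)
    - g.inner x (VectorField.mlieBracket (𝓡 n) X Z x) (Y x)
    - g.inner x (VectorField.mlieBracket (𝓡 n) Y Z x) (X x))

theorem mdifferentiableAt_inner (g : Metric n M) {X Y : ∀ x : M, TangentSpace (𝓡 n) x} {x : M}
    (hX : MDifferentiableAt (𝓡 n) (𝓡 n).tangent
      (fun x => (TotalSpace.mk' (EuclideanSpace ℝ (Fin n)) x (X x) : TangentBundle (𝓡 n) M)) x)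
    (hY : MDifferentiableAt (𝓡 n) (𝓡 n).tangent
      (fun x => (TotalSpace.mk' (EuclideanSpace ℝ (Fin n)) x (Y x) : TangentBundle (𝓡 n) M)) x) :
    MDifferentiableAt (𝓡 n) 𝓘(ℝ, ℝ) (fun y => g.inner y (X y) (Y y)) x := by
  have hg := (g.contMDiff x).mdifferentiableAt (by simp)
  have := MDifferentiableAt.clm_bundle_apply₂ (F₃ := ℝ) (E₃ := Trivial M ℝ) hg hX hY
  rw [mdifferentiableAt_totalSpace] at this
  exact this.2

theorem tensorialAt_koszul (g : Metric n M) (X Y : VF n M) (x : M) :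
    TensorialAt (𝓡 n) (EuclideanSpace ℝ (Fin n)) (fun Z => koszul g X Y Z x) x := by
  have : IsManifold (𝓡 n) 2 M := IsManifold.of_le (n := ∞) (by norm_cast)
  have hX := X.mdifferentiableAt (x := x)
  have hY := Y.mdifferentiableAt (x := x)
  constructor
  · intro f Z hf hZ
    have h1 := mdifferentiableAt_inner g hX hZ
    have h2 := mdifferentiableAt_inner g hY hZ
    simp only [koszul, lieDer, Pi.smul_apply', map_smul, smul_eq_mul, _root_.smul_apply,
      VectorField.mlieBracket_smul_right hf hZ, map_add, _root_.add_apply]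
    rw [mvfderiv_fun_mul hf h1, mvfderiv_fun_mul hf h2]
    simp [g.symm x (Z x)]
    ring
  · intro Z Z' hZ hZ'
    simp only [koszul, lieDer, Pi.add_apply, map_add, _root_.add_apply,
      VectorField.mlieBracket_add_right hZ hZ']
    rw [mvfderiv_fun_add (mdifferentiableAt_inner g hX hZ) (mdifferentiableAt_inner g hX hZ'),
      mvfderiv_fun_add (mdifferentiableAt_inner g hY hZ) (mdifferentiableAt_inner g hY hZ')]
    simp
    ring

theorem metric_nondegenerate (g : Metric n M) (x : M) (v : TangentSpace (𝓡 n) x)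
    (h : ∀ w, g.inner x v w = 0) : v = 0 := by
  by_contra hv
  exact (g.pos x v hv).ne' (h v)

instance (x : M) : FiniteDimensional ℝ (TangentSpace (𝓡 n) x) :=
  inferInstanceAs (FiniteDimensional ℝ (EuclideanSpace ℝ (Fin n)))

instance (x : M) : T2Space (TangentSpace (𝓡 n) x) :=
  inferInstanceAs (T2Space (EuclideanSpace ℝ (Fin n)))

/-- The Levi-Civita covariant derivative `∇_X Y` of `g`, defined by the Koszul formula. -/
def leviCivita (g : Metric n M) (X Y : VF n M) (x : M) : TangentSpace (𝓡 n) x :=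
  riesz (g.inner x) (metric_nondegenerate g x)
    (TensorialAt.mkHom (fun Z => koszul g X Y Z x) x (tensorialAt_koszul g X Y x))

theorem inner_leviCivita (g : Metric n M) (X Y : VF n M) {Z : ∀ x : M, TangentSpace (𝓡 n) x}
    {x : M} (hZ : MDifferentiableAt (𝓡 n) (𝓡 n).tangent
      (fun x => (TotalSpace.mk' (EuclideanSpace ℝ (Fin n)) x (Z x) : TangentBundle (𝓡 n) M)) x) :
    g.inner x (leviCivita g X Y x) (Z x) = koszul g X Y Z x := by
  rw [leviCivita, apply_riesz]
  exact TensorialAt.mkHom_apply _ hZ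

/-- The Levi-Civita connection is torsion-free. -/
theorem leviCivita_sub_leviCivita (g : Metric n M) (X Y : VF n M) (x : M) :
    leviCivita g X Y x - leviCivita g Y X x = VectorField.mlieBracket (𝓡 n) X Y x := by
  rw [← sub_eq_zero]
  refine metric_nondegenerate g x _ fun w => ?_
  have hZ := FiberBundle.mdifferentiableAt_extend (𝓡 n) (EuclideanSpace ℝ (Fin n)) w
  have h1 := inner_leviCivita g X Y hZ
  have h2 := inner_leviCivita g Y X hZ
  have h3 : VectorField.mlieBracket (𝓡 n) Y X x = - VectorField.mlieBracket (𝓡 n) X Y x := by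
    rw [VectorField.mlieBracket_swap]; rfl
  simp only [FiberBundle.extend_apply_self, koszul, h3, map_neg, _root_.neg_apply,
    fun y => g.symm y (Y y) (X y)] at h1 h2
  simp only [map_sub, _root_.sub_apply, h1, h2]
  ring

/-- The Levi-Civita connection is compatible with the metric. -/
theorem lieDer_inner (g : Metric n M) (X Y Z : VF n M) (x : M) :
    lieDer X (fun y => g.inner y (Y y) (Z y)) x =
      g.inner x (leviCivita g X Y x) (Z x) + g.inner x (Y x) (leviCivita g X Z x) := by
  have h3 : VectorField.mlieBracket (𝓡 n) Z Y x = - VectorField.mlieBracket (𝓡 n) Y Z x := by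
    rw [VectorField.mlieBracket_swap]; rfl
  rw [g.symm x (Y x), inner_leviCivita g X Y Z.mdifferentiableAt,
    inner_leviCivita g X Z Y.mdifferentiableAt]
  simp only [koszul, h3, map_neg, _root_.neg_apply, fun y => g.symm y (Z y) (Y y)]
  ring

end LeviCivita

section Courant

variable (n : ℕ) {M : Type*} [TopologicalSpace M] [ChartedSpace (EuclideanSpace ℝ (Fin n)) M]
  [IsManifold (𝓡 n) ∞ M]
  (F : Type*) [NormedAddCommGroup F] [NormedSpace ℝ F] [FiniteDimensional ℝ F]
  (E : M → Type*) [∀ x, AddCommGroup (E x)] [∀ x, Module ℝ (E x)]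
  [∀ x, TopologicalSpace (E x)] [∀ x, IsTopologicalAddGroup (E x)]
  [∀ x, ContinuousSMul ℝ (E x)] [TopologicalSpace (TotalSpace F E)] [FiberBundle F E]
  [VectorBundle ℝ F E] [ContMDiffVectorBundle ∞ F E (𝓡 n)]

/-- The structure of an exact Courant algebroid on the vector bundle `E → M`, with the
(non-skew) Dorfman bracket. The last two fields say that
`0 → T*M → E → TM → 0`, with the maps `ρ*` and `ρ`, is exact; here `ρ*ξ ∈ E` is defined by
`⟨ρ*ξ, e⟩ = ξ (ρ e)`. -/
structure ExactCourantAlgebroid where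
  /-- the pairing `⟨·, ·⟩` -/
  pairing : ∀ x, E x →L[ℝ] E x →L[ℝ] ℝ
  pairing_contMDiff : ContMDiff (𝓡 n) ((𝓡 n).prod 𝓘(ℝ, F →L[ℝ] F →L[ℝ] ℝ)) ∞
    (fun x => TotalSpace.mk' (F →L[ℝ] F →L[ℝ] ℝ) x (pairing x))
  pairing_symm : ∀ x a b, pairing x a b = pairing x b a
  pairing_nondegenerate : ∀ x a, (∀ b, pairing x a b = 0) → a = 0
  /-- the anchor `ρ` -/
  anchor : ∀ x, E x →L[ℝ] TangentSpace (𝓡 n) x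
  anchor_contMDiff : ContMDiff (𝓡 n) ((𝓡 n).prod 𝓘(ℝ, F →L[ℝ] EuclideanSpace ℝ (Fin n))) ∞
    (fun x => TotalSpace.mk' (F →L[ℝ] EuclideanSpace ℝ (Fin n)) x (anchor x))
  /-- the bracket `[·, ·]` -/
  bracket : Sec n F E →ₗ[ℝ] Sec n F E →ₗ[ℝ] Sec n F E
  bracket_jacobi : ∀ a b c,
    bracket a (bracket b c) = bracket (bracket a b) c + bracket b (bracket a c)
  anchor_bracket : ∀ a b x, anchor x (bracket a b x) =
    VectorField.mlieBracket (𝓡 n) (fun y => anchor y (a y)) (fun y => anchor y (b y)) x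
  bracket_smul : ∀ a b (f : C^∞⟮𝓡 n, M; ℝ⟯) x, bracket a (f • b) x =
    f x • bracket a b x + lieDer (fun y => anchor y (a y)) f x • b x
  lieDer_pairing : ∀ a b c : Sec n F E, ∀ x,
    lieDer (fun y => anchor y (a y)) (fun y => pairing y (b y) (c y)) x =
      pairing x (bracket a b x) (c x) + pairing x (b x) (bracket a c x)
  bracket_add_swap : ∀ a b c : Sec n F E, ∀ x,
    pairing x (bracket a b x + bracket b a x) (c x) =
      lieDer (fun y => anchor y (c y)) (fun y => pairing y (a y) (b y)) x
  anchor_surjective : ∀ x, Function.Surjective (anchor x)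
  anchor_eq_zero_iff : ∀ x e, anchor x e = 0 ↔
    ∃ ξ : TangentSpace (𝓡 n) x →L[ℝ] ℝ, ∀ e', pairing x e e' = ξ (anchor x e')

namespace ExactCourantAlgebroid

variable {n F E}
variable (C : ExactCourantAlgebroid n F E)

/-- The vector field `ρ(e)` of a section `e`. -/
def anchorSec (e : Sec n F E) : VF n M :=
  ⟨fun x => C.anchor x (e x), C.anchor_contMDiff.clm_bundle_apply e.contMDiff⟩

/-- The orthogonal `W^⊥` with respect to the pairing. -/
def orth (W : ∀ x, Submodule ℝ (E x)) (x : M) : Submodule ℝ (E x) where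
  carrier := {e | ∀ w ∈ W x, C.pairing x e w = 0}
  add_mem' ha hb w hw := by simp [ha w hw, hb w hw]
  zero_mem' w _ := by simp
  smul_mem' c a ha w hw := by simp [ha w hw]

/-- A generalized metric: a positive definite subbundle `V ⊆ E` of rank `n = dim M`. -/
structure GeneralizedMetric where
  fiber : ∀ x, Submodule ℝ (E x)
  isSubbundle : IsSubbundle n F fiber
  finrank_eq : ∀ x, finrank ℝ (fiber x) = n
  pos : ∀ x, ∀ e ∈ fiber x, e ≠ 0 → 0 < C.pairing x e e

/-- A (regular) small Dirac structure: an isotropic subbundle `D ⊆ E` with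
`[Γ(D), Γ(D)] ⊆ Γ(D)`. -/
structure SmallDirac where
  fiber : ∀ x, Submodule ℝ (E x)
  isSubbundle : IsSubbundle n F fiber
  isotropic : ∀ x, ∀ a ∈ fiber x, ∀ b ∈ fiber x, C.pairing x a b = 0
  involutive : ∀ a ∈ secs n F fiber, ∀ b ∈ secs n F fiber, C.bracket a b ∈ secs n F fiber

variable {C}

/-- `W` is a `D`-transverse generalized metric. -/
structure IsTransverseGeneralizedMetric (D : C.SmallDirac) (W : ∀ x, Submodule ℝ (E x)) :
    Prop where
  isSubbundle : IsSubbundle n F W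
  finrank_eq : ∀ x, finrank ℝ (W x) = n
  le : ∀ x, D.fiber x ≤ W x
  le_orth : ∀ x, W x ≤ C.orth D.fiber x
  pos : ∀ x, ∀ w ∈ W x, w ∉ D.fiber x → 0 < C.pairing x w w
  invariant : ∀ a ∈ secs n F D.fiber, ∀ w ∈ secs n F W, C.bracket a w ∈ secs n F W

/-- `V_D = D ⊕ (D^⊥ ∩ V)`; the sum is direct since `D` is isotropic and `V` is positive
definite. -/
def transverseOf (V : C.GeneralizedMetric) (D : C.SmallDirac) (x : M) : Submodule ℝ (E x) :=
  D.fiber x ⊔ (C.orth D.fiber x ⊓ V.fiber x)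

/-- `(E, V, D)` is a Dirac-Riemannian foliation. -/
def IsDiracRiemannianFoliation (V : C.GeneralizedMetric) (D : C.SmallDirac) : Prop :=
  IsTransverseGeneralizedMetric D (transverseOf V D)

namespace GeneralizedMetric

variable (V : C.GeneralizedMetric)

theorem anchor_bijective (x : M) :
    Function.Bijective ((C.anchor x : E x →ₗ[ℝ] TangentSpace (𝓡 n) x).domRestrict
      (V.fiber x)) := by
  have : FiniteDimensional ℝ (E x) := VectorBundle.finiteDimensional ℝ F E x
  have hinj : Function.Injective ((C.anchor x : E x →ₗ[ℝ] TangentSpace (𝓡 n) x).domRestrict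
      (V.fiber x)) := by
    rw [← LinearMap.ker_eq_bot, LinearMap.ker_eq_bot']
    rintro ⟨e, he⟩ h
    have h0 : C.anchor x e = 0 := h
    obtain ⟨ξ, hξ⟩ := (C.anchor_eq_zero_iff x e).1 h0
    by_contra hne
    have := V.pos x e he (fun h => hne (by simp [h]))
    rw [hξ e, h0, map_zero] at this
    exact lt_irrefl _ this
  refine ⟨hinj, (LinearMap.injective_iff_surjective_of_finrank_eq_finrank ?_).1 hinj⟩
  rw [V.finrank_eq x]
  exact (finrank_euclideanSpace_fin (𝕜 := ℝ) (n := n)).symm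

/-- The inverse `u ↦ u₊` of the isomorphism `ρ|_V : V → TM`. -/
def lift (x : M) : TangentSpace (𝓡 n) x →L[ℝ] E x :=
  LinearMap.toContinuousLinearMap ((V.fiber x).subtype ∘ₗ
    ((LinearEquiv.ofBijective _ (V.anchor_bijective x)).symm :
      TangentSpace (𝓡 n) x →ₗ[ℝ] V.fiber x))

theorem lift_mem (x : M) (u : TangentSpace (𝓡 n) x) : V.lift x u ∈ V.fiber x := by
  simp [lift]

@[simp] theorem anchor_lift (x : M) (u : TangentSpace (𝓡 n) x) :
    C.anchor x (V.lift x u) = u :=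
  (LinearEquiv.ofBijective _ (V.anchor_bijective x)).apply_symm_apply u

theorem lift_anchor {x : M} {e : E x} (he : e ∈ V.fiber x) : V.lift x (C.anchor x e) = e :=
  congrArg Subtype.val
    ((LinearEquiv.ofBijective _ (V.anchor_bijective x)).symm_apply_apply ⟨e, he⟩)

/-- The inner product `g x u v = ⟨u₊, v₊⟩ / 2` on `T_xM`. -/
def metricAt (x : M) : TangentSpace (𝓡 n) x →L[ℝ] TangentSpace (𝓡 n) x →L[ℝ] ℝ :=
  (1 / 2 : ℝ) • (ContinuousLinearMap.precomp ℝ (V.lift x)).comp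
    ((C.pairing x).comp (V.lift x))

@[simp] theorem metricAt_apply (x : M) (u v : TangentSpace (𝓡 n) x) :
    V.metricAt x u v = 1 / 2 * C.pairing x (V.lift x u) (V.lift x v) := by
  simp [metricAt]

theorem metricAt_pos (x : M) (u : TangentSpace (𝓡 n) x) (hu : u ≠ 0) :
    0 < V.metricAt x u u := by
  rw [metricAt_apply]
  have hne : V.lift x u ≠ 0 := fun h => hu (by rw [← V.anchor_lift x u, h, map_zero])
  have := V.pos x _ (V.lift_mem x u) hne
  positivity

theorem contMDiffAt_lift {x₀ : M} {u : ∀ x : M, TangentSpace (𝓡 n) x}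
    (hu : ContMDiffAt (𝓡 n) ((𝓡 n).prod 𝓘(ℝ, EuclideanSpace ℝ (Fin n))) ∞
      (fun x => TotalSpace.mk' (EuclideanSpace ℝ (Fin n)) x (u x)) x₀) :
    ContMDiffAt (𝓡 n) ((𝓡 n).prod 𝓘(ℝ, F)) ∞
      (fun x => TotalSpace.mk' F x (V.lift x (u x))) x₀ := by
  obtain ⟨U, hU, hx₀, k, s, hs, hfr⟩ := V.isSubbundle x₀
  have hs' : ∀ i, ContMDiffAt (𝓡 n) ((𝓡 n).prod 𝓘(ℝ, F)) ∞
      (fun x => TotalSpace.mk' F x (s i x)) x₀ := fun i => (hs i).contMDiffAt (hU.mem_nhds hx₀)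
  have hmem : ∀ x ∈ U, ∀ i, s i x ∈ V.fiber x := fun x hx i => by
    rw [← (hfr x hx).2]
    exact Submodule.subset_span ⟨i, rfl⟩
  -- the frame as a bundle map from a trivial bundle
  let B : ∀ x, Trivial M (Fin k → ℝ) x →L[ℝ] E x := fun x =>
    ∑ i, (ContinuousLinearMap.proj (R := ℝ) (φ := fun _ : Fin k => ℝ) i).smulRight (s i x)
  have hB : ∀ x (c : Fin k → ℝ), B x c = ∑ i, c i • s i x := fun x c => by
    simp [B]
  have hBs : ∀ c : M → Fin k → ℝ, ContMDiffAt (𝓡 n) 𝓘(ℝ, Fin k → ℝ) ∞ c x₀ →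
      ContMDiffAt (𝓡 n) ((𝓡 n).prod 𝓘(ℝ, F)) ∞
        (fun x => TotalSpace.mk' F x (B x (c x))) x₀ := by
    intro c hc
    simp only [hB]
    refine ContMDiffAt.sum_section fun i _ => ?_
    exact ContMDiffAt.smul_section (f := fun x => c x i)
      (contMDiffAt_pi_space.1 hc i) (hs' i)
  let ϕ : ∀ x, Trivial M (Fin k → ℝ) x →L[ℝ] TangentSpace (𝓡 n) x := fun x =>
    (C.anchor x).comp (B x)
  have hϕ : ContMDiffAt (𝓡 n) ((𝓡 n).prod 𝓘(ℝ, (Fin k → ℝ) →L[ℝ] EuclideanSpace ℝ (Fin n))) ∞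
      (fun x => TotalSpace.mk' ((Fin k → ℝ) →L[ℝ] EuclideanSpace ℝ (Fin n)) x (ϕ x)) x₀ := by
    refine contMDiffAt_hom_of_apply (E₁ := Trivial M (Fin k → ℝ)) fun v hv => ?_
    rw [contMDiffAt_totalSpace] at hv
    exact (C.anchor_contMDiff x₀).clm_bundle_apply (hBs _ hv.2)
  have hϕb : ∀ x ∈ U, Function.Bijective (ϕ x) := by
    intro x hx
    constructor
    · rw [← ContinuousLinearMap.coe_coe, ← LinearMap.ker_eq_bot, LinearMap.ker_eq_bot']
      intro c hc
      have hmemV : B x c ∈ V.fiber x := by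
        rw [hB]
        exact Submodule.sum_mem _ fun i _ => Submodule.smul_mem _ _ (hmem x hx i)
      have h0 : B x c = 0 := by
        rw [← V.lift_anchor hmemV]
        have : C.anchor x (B x c) = 0 := hc
        rw [this, map_zero]
      rw [hB] at h0
      exact funext (Fintype.linearIndependent_iff.1 (hfr x hx).1 c h0)
    · intro w
      have : V.lift x w ∈ Submodule.span ℝ (range fun i => s i x) := by
        rw [(hfr x hx).2]; exact V.lift_mem x w
      obtain ⟨c, hc⟩ := (Submodule.mem_span_range_iff_exists_fun ℝ).1 this
      refine ⟨c, ?_⟩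
      change C.anchor x (B x c) = w
      rw [hB, hc, V.anchor_lift]
  -- coefficients of `u₊` in the frame
  have hc : ∀ x, ∃ c : Fin k → ℝ, x ∈ U → ϕ x c = u x := fun x => by
    by_cases hx : x ∈ U
    · obtain ⟨c, hc⟩ := (hϕb x hx).2 (u x)
      exact ⟨c, fun _ => hc⟩
    · exact ⟨0, fun h => absurd h hx⟩
  choose c hc using hc
  have hcs := contMDiffAt_of_hom_apply (E₁ := Trivial M (Fin k → ℝ)) hϕ (hϕb x₀ hx₀) (v := c)
    (hu.congr_of_eventuallyEq (by
      filter_upwards [hU.mem_nhds hx₀] with x hx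
      rw [hc x hx]))
  rw [contMDiffAt_totalSpace] at hcs
  refine (hBs c hcs.2).congr_of_eventuallyEq ?_
  filter_upwards [hU.mem_nhds hx₀] with x hx
  congr 1
  have hmemV : B x (c x) ∈ V.fiber x := by
    rw [hB]
    exact Submodule.sum_mem _ fun i _ => Submodule.smul_mem _ _ (hmem x hx i)
  rw [← V.lift_anchor hmemV]
  congr 1
  exact (hc x hx).symm

theorem contMDiffAt_pairing {x₀ : M} {a b : ∀ x, E x}
    (ha : ContMDiffAt (𝓡 n) ((𝓡 n).prod 𝓘(ℝ, F)) ∞ (fun x => TotalSpace.mk' F x (a x)) x₀)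
    (hb : ContMDiffAt (𝓡 n) ((𝓡 n).prod 𝓘(ℝ, F)) ∞ (fun x => TotalSpace.mk' F x (b x)) x₀) :
    ContMDiffAt (𝓡 n) ((𝓡 n).prod 𝓘(ℝ, ℝ)) ∞
      (fun x => TotalSpace.mk' ℝ (E := Trivial M ℝ) x (C.pairing x (a x) (b x))) x₀ :=
  ContMDiffAt.clm_bundle_apply₂ (F₃ := ℝ) (E₃ := Trivial M ℝ) (C.pairing_contMDiff x₀) ha hb

/-- The Riemannian metric `g` of a generalized metric: `V` is the graph of `g` in the splitting
of `E` defined by `V`, so `⟨u₊, v₊⟩ = 2 g(u, v)`. -/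
def metric : Metric n M where
  inner := V.metricAt
  symm x u v := by rw [metricAt_apply, metricAt_apply, C.pairing_symm]
  pos := V.metricAt_pos
  isVonNBounded x := by
    refine isVonNBounded_of_pos (W := EuclideanSpace ℝ (Fin n)) (V.metricAt x) fun u hu => ?_
    exact V.metricAt_pos x u hu
  contMDiff x₀ := by
    refine contMDiffAt_hom_of_apply (F₂ := EuclideanSpace ℝ (Fin n) →L[ℝ] ℝ)
      (E₂ := fun x : M => TangentSpace (𝓡 n) x →L[ℝ] Trivial M ℝ x) fun u hu => ?_
    refine contMDiffAt_hom_of_apply (E₂ := Trivial M ℝ) fun v hv => ?_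
    simp only [metricAt_apply]
    exact ContMDiffAt.const_smul_section (a := (1 / 2 : ℝ))
      (contMDiffAt_pairing (V.contMDiffAt_lift hu) (V.contMDiffAt_lift hv))

/-- The map `ρ* ∘ g : TM → T*M → E`. -/
def coLift (x : M) : TangentSpace (𝓡 n) x →ₗ[ℝ] E x :=
  have : T2Space (E x) := FiberBundle.t2Space F E x
  have : FiniteDimensional ℝ (E x) := VectorBundle.finiteDimensional ℝ F E x
  riesz (C.pairing x) (C.pairing_nondegenerate x) ∘ₗ
    ((ContinuousLinearMap.precomp ℝ (C.anchor x)).comp (V.metricAt x) :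
      TangentSpace (𝓡 n) x →ₗ[ℝ] E x →L[ℝ] ℝ)

theorem pairing_coLift (x : M) (u : TangentSpace (𝓡 n) x) (e : E x) :
    C.pairing x (V.coLift x u) e = V.metricAt x u (C.anchor x e) := by
  have : T2Space (E x) := FiberBundle.t2Space F E x
  have : FiniteDimensional ℝ (E x) := VectorBundle.finiteDimensional ℝ F E x
  simp only [coLift, LinearMap.comp_apply, apply_riesz]
  rfl

theorem contMDiffAt_coLift {x₀ : M} {u : ∀ x : M, TangentSpace (𝓡 n) x}
    (hu : ContMDiffAt (𝓡 n) ((𝓡 n).prod 𝓘(ℝ, EuclideanSpace ℝ (Fin n))) ∞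
      (fun x => TotalSpace.mk' (EuclideanSpace ℝ (Fin n)) x (u x)) x₀) :
    ContMDiffAt (𝓡 n) ((𝓡 n).prod 𝓘(ℝ, F)) ∞
      (fun x => TotalSpace.mk' F x (V.coLift x (u x))) x₀ := by
  have : T2Space (E x₀) := FiberBundle.t2Space F E x₀
  have : FiniteDimensional ℝ (E x₀) := VectorBundle.finiteDimensional ℝ F E x₀
  refine contMDiffAt_of_hom_apply (F₂ := F →L[ℝ] ℝ)
    (E₂ := fun x : M => E x →L[ℝ] Trivial M ℝ x) (C.pairing_contMDiff x₀)
    (bijective_of_nondegenerate _ (C.pairing_nondegenerate x₀)) ?_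
  refine contMDiffAt_hom_of_apply (E₂ := Trivial M ℝ) fun v hv => ?_
  simp only [pairing_coLift]
  exact ContMDiffAt.clm_bundle_apply₂ (F₃ := ℝ) (E₃ := Trivial M ℝ) (V.metric.contMDiff x₀) hu
    ((C.anchor_contMDiff x₀).clm_bundle_apply hv)

/-- The splitting `s : TM → E` of `E` determined by `V`: since `u₊ = s(u) + ρ* (g u)`, it is the
isotropic splitting in which `V` is the graph of the metric `g`. -/
def splitting (x : M) : TangentSpace (𝓡 n) x →ₗ[ℝ] E x := V.lift x - V.coLift x

@[simp] theorem anchor_splitting (x : M) (u : TangentSpace (𝓡 n) x) :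
    C.anchor x (V.splitting x u) = u := by
  have : C.anchor x (V.coLift x u) = 0 :=
    (C.anchor_eq_zero_iff x _).2 ⟨V.metricAt x u, V.pairing_coLift x u⟩
  simp [splitting, this]

/-- The splitting is isotropic. -/
theorem pairing_splitting (x : M) (u v : TangentSpace (𝓡 n) x) :
    C.pairing x (V.splitting x u) (V.splitting x v) = 0 := by
  have h0 : C.anchor x (V.coLift x v) = 0 :=
    (C.anchor_eq_zero_iff x _).2 ⟨V.metricAt x v, V.pairing_coLift x v⟩
  have h1 := V.pairing_coLift x u
  have h2 : C.pairing x (V.lift x u) (V.coLift x v) = V.metricAt x u v := by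
    rw [C.pairing_symm, V.pairing_coLift, V.anchor_lift]
    exact V.metric.symm x v u
  simp [splitting, h1, h2, h0]
  ring

/-- `s(X)` as a section of `E`, for a vector field `X`. -/
def splittingSec (X : VF n M) : Sec n F E :=
  ⟨fun x => V.splitting x (X x), fun x =>
    (V.contMDiffAt_lift (X.contMDiff x)).sub_section (V.contMDiffAt_coLift (X.contMDiff x))⟩

/-- The 3-form of `E` in the splitting defined by `V`: `H(X, Y, Z) = ⟨[s X, s Y], s Z⟩`. -/
def threeForm (X Y Z : VF n M) (x : M) : ℝ :=
  C.pairing x (C.bracket (V.splittingSec X) (V.splittingSec Y) x) (V.splittingSec Z x)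

end GeneralizedMetric

namespace SmallDirac

variable (D : C.SmallDirac)

/-- The `C^∞(M)`-module `Γ(D)`. -/
abbrev Sections := secs n F D.fiber

/-- The value at `x` of a section of `D`. -/
def fiberVal (e : D.Sections) (x : M) : D.fiber x := ⟨e.1 x, e.2 x⟩

/-- Connections on the vector bundle `D`. -/
structure Connection where
  toFun : VF n M → D.Sections → D.Sections
  add_left : ∀ X Y e, toFun (X + Y) e = toFun X e + toFun Y e
  smul_left : ∀ (f : C^∞⟮𝓡 n, M; ℝ⟯) X e, toFun (f • X) e = f • toFun X e
  add_right : ∀ X e e', toFun X (e + e') = toFun X e + toFun X e'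
  leibniz : ∀ (f : C^∞⟮𝓡 n, M; ℝ⟯) X e x,
    D.fiberVal (toFun X (f • e)) x = f x • D.fiberVal (toFun X e) x + lieDer X f x • D.fiberVal e x

instance : CoeFun D.Connection (fun _ => VF n M → D.Sections → D.Sections) :=
  ⟨Connection.toFun⟩

/-- `Ω¹(End D)`: 1-forms on `M` with values in the endomorphisms of `D`. -/
abbrev EndForm :=
  VF n M →ₗ[C^∞⟮𝓡 n, M; ℝ⟯] D.Sections →ₗ[C^∞⟮𝓡 n, M; ℝ⟯] D.Sections

/-- Families of elements of the fibres of `D* ⊗ T*M`. -/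
abbrev DualForm := ∀ x : M, D.fiber x →ₗ[ℝ] TangentSpace (𝓡 n) x →ₗ[ℝ] ℝ

/-- `α_D ∈ Γ(D* ⊗ T*M)`: the `T*M`-component of the inclusion `D → E ≅ TM ⊕ T*M`, in the
splitting defined by `V`; for `e = s(X) + ρ*(α)` one has `⟨e, s v⟩ = α(v)`. -/
def alpha (V : C.GeneralizedMetric) : D.DualForm := fun x =>
  ((C.pairing x).toLinearMap₁₂.compl₂ (V.splitting x)).domRestrict (D.fiber x)

/-- `ι_{ρ_D} g ∈ Γ(D* ⊗ T*M)`. -/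
def rhoBar (V : C.GeneralizedMetric) : D.DualForm := fun x =>
  ((V.metric.inner x).toLinearMap₁₂.comp (C.anchor x : E x →ₗ[ℝ] TangentSpace (𝓡 n) x)).domRestrict
    (D.fiber x)

variable {D}

/-- `((∇̄_u β) e) v` for `β ∈ Γ(D* ⊗ T*M)`, where `∇̄` is the connection on `D* ⊗ T*M` induced
by `∇` and by the Levi-Civita connection of the metric `g`. -/
def Connection.extend (nabla : D.Connection) (g : Metric n M) (β : D.DualForm)
    (e : D.Sections) (u v : VF n M) (x : M) : ℝ :=
  lieDer u (fun y => β y (D.fiberVal e y) (v y)) x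
    - β x (D.fiberVal (nabla u e) x) (v x)
    - β x (D.fiberVal e x) (leviCivita g u v x)

/-- `((φ*_u β) e) v` for `β ∈ Γ(D* ⊗ T*M)`, where `φ* ∈ Ω¹(End D*)` is dual to `φ`. -/
def EndForm.dual (φ : D.EndForm) (β : D.DualForm) (e : D.Sections) (u v : VF n M) (x : M) : ℝ :=
  β x (D.fiberVal (φ u e) x) (v x)

end SmallDirac

/-- Symmetrization of a bilinear expression in two vector fields. -/
def symPart (T : VF n M → VF n M → M → ℝ) (u v : VF n M) (x : M) : ℝ :=
  (1 / 2) * (T u v x + T v u x)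

/-- Antisymmetrization of a bilinear expression in two vector fields. -/
def altPart (T : VF n M → VF n M → M → ℝ) (u v : VF n M) (x : M) : ℝ :=
  (1 / 2) * (T u v x - T v u x)

/-- `Sym (∇̄ ρ̄_D - φ* α_D) = 0`. -/
def SymCompatible (V : C.GeneralizedMetric) (D : C.SmallDirac) (nabla : D.Connection)
    (φ : D.EndForm) : Prop :=
  ∀ (e : D.Sections) (u v : VF n M) (x : M),
    symPart (fun u v x => nabla.extend V.metric (D.rhoBar V) e u v x
      - SmallDirac.EndForm.dual φ (D.alpha V) e u v x) u v x = 0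

/-- `Alt (∇̄ α_D - φ* ρ̄_D - ½ ι_{ρ_D} H) = 0`. -/
def AltCompatible (V : C.GeneralizedMetric) (D : C.SmallDirac) (nabla : D.Connection)
    (φ : D.EndForm) : Prop :=
  ∀ (e : D.Sections) (u v : VF n M) (x : M),
    altPart (fun u v x => nabla.extend V.metric (D.alpha V) e u v x
      - SmallDirac.EndForm.dual φ (D.rhoBar V) e u v x
      - (1 / 2) * V.threeForm (C.anchorSec e.1) u v x) u v x = 0

end ExactCourantAlgebroid

end Courant

end

end DiracRiemann

/-! The generalized metric splits E = V ⊕ V^⊥ with V^⊥ negative definite, and the anchor maps each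
summand isomorphically onto TM, with inverses u ↦ u₊ and v ↦ v₋; subscripts ± also denote the
components of an element of E. For e = s(X) + ρ*α in Γ(D), Cartan calculus gives ⟨[e, u₊], v₋⟩ =
(L_X g)(u, v) - dα(u, v) + H(X, u, v) (`pairing_bracket_liftSec_lowerLiftSec`). The Koszul formula
expresses L_X g through the symmetrized Levi-Civita derivative, and torsion-freeness expresses dα
through the antisymmetrized one. Hence T(u, v) = ⟨[e, u₊], v₋⟩ - ⟨∇⁺_v e, u₊⟩ + ⟨∇⁻_u e, v₋⟩ is
twice the symmetric expression (1) minus twice the antisymmetric expression (2)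
(`pairing_bracket_sub_eq_symPart_sub_altPart`), so (1) and (2) together say T = 0.

On the other side, all conditions on V_D except invariance are automatic. An isotropic D meets V^⊥
only in 0, so (d, d') ↦ ⟨d₊, d'⟩ is an inner product on D, and V_D is the graph of a smooth map V →
V^⊥. Invariance reduces to ⟨[e, a], b⟩ = 0 for sections a of V ∩ D^⊥ and b of V^⊥ ∩ D^⊥
(`isDiracRiemannianFoliation_iff`).

If T = 0, inserting u₊ = a and v₋ = b kills both connection terms, because ∇± e lies in D.
Conversely, the bracket and the inner product on D define global connections `connPlus` and
`connMinus` for which T(u, v) = ⟨[e, u'], v'⟩, where u' and v' are the D^⊥-components of u₊ and v₋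
(`pairing_bracket_sub_connPlus_add_connMinus`); this vanishes for a Dirac-Riemannian foliation. -/

namespace DiracRiemann

noncomputable section

/-! ### Representing bilinear forms on a subspace -/

section LinearAlgebra

/-- If `B` is nondegenerate on the finite-dimensional subspace `W`, each bilinear form `β` is
represented by a linear map with values in `W`. -/
theorem exists_linearMap_representing {A : Type*} [AddCommGroup A] [Module ℝ A]
    [FiniteDimensional ℝ A] (W : Submodule ℝ A) (B β : A →ₗ[ℝ] A →ₗ[ℝ] ℝ)
    (hB : ∀ w ∈ W, (∀ w' ∈ W, B w w' = 0) → w = 0) :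
    ∃ q : A →ₗ[ℝ] A, ∀ z, q z ∈ W ∧ ∀ w ∈ W, B (q z) w = β z w := by
  let f : W →ₗ[ℝ] Module.Dual ℝ W := W.dualRestrict ∘ₗ B ∘ₗ W.subtype
  have hinj : Function.Injective f := by
    rw [← LinearMap.ker_eq_bot, LinearMap.ker_eq_bot']
    intro w hw
    exact Subtype.ext (hB w w.2 fun w' hw' => congrArg (fun l : Module.Dual ℝ W => l ⟨w', hw'⟩) hw)
  let e : W ≃ₗ[ℝ] Module.Dual ℝ W :=
    LinearEquiv.ofInjectiveOfFinrankEq f hinj Subspace.dual_finrank_eq.symm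
  refine ⟨W.subtype ∘ₗ (e.symm : Module.Dual ℝ W →ₗ[ℝ] W) ∘ₗ W.dualRestrict ∘ₗ β,
    fun z => ⟨Subtype.prop _, fun w hw => ?_⟩⟩
  have : e (e.symm (W.dualRestrict (β z))) = W.dualRestrict (β z) := e.apply_symm_apply _
  exact congrArg (fun l : Module.Dual ℝ W => l ⟨w, hw⟩) this

end LinearAlgebra

/-! ### Smooth sections and projections of subbundles -/

section Subbundles

variable {n : ℕ} {M : Type*} [TopologicalSpace M] [ChartedSpace (EuclideanSpace ℝ (Fin n)) M]
  {F : Type*} [NormedAddCommGroup F] [NormedSpace ℝ F] [FiniteDimensional ℝ F]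
  {E : M → Type*} [∀ x, AddCommGroup (E x)] [∀ x, Module ℝ (E x)]
  [∀ x, TopologicalSpace (E x)] [TopologicalSpace (TotalSpace F E)] [FiberBundle F E]
  [VectorBundle ℝ F E] [ContMDiffVectorBundle ∞ F E (𝓡 n)]

variable (n F) in
/-- Smoothness at a point of a section of a vector bundle. -/
abbrev SmoothSecAt (s : ∀ x, E x) (x₀ : M) : Prop :=
  ContMDiffAt (𝓡 n) ((𝓡 n).prod 𝓘(ℝ, F)) ∞ (fun x => TotalSpace.mk' F x (s x)) x₀

/-- A section of a subbundle is smooth if its products with the smooth sections of the subbundle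
are, for a smooth bilinear form that is nondegenerate on the subbundle. -/
theorem IsSubbundle.smoothSecAt {W : ∀ x, Submodule ℝ (E x)} (hW : IsSubbundle n F W) {x₀ : M}
    {B : ∀ x, E x →ₗ[ℝ] E x →ₗ[ℝ] ℝ}
    (hBs : ∀ a b : ∀ x, E x, SmoothSecAt n F a x₀ → SmoothSecAt n F b x₀ →
      ContMDiffAt (𝓡 n) 𝓘(ℝ, ℝ) ∞ (fun x => B x (a x) (b x)) x₀)
    (hB : ∀ w ∈ W x₀, (∀ w' ∈ W x₀, B x₀ w w' = 0) → w = 0)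
    {d : ∀ x, E x} (hd : ∀ x, d x ∈ W x)
    (h : ∀ w : ∀ x, E x, SmoothSecAt n F w x₀ → (∀ᶠ x in 𝓝 x₀, w x ∈ W x) →
      ContMDiffAt (𝓡 n) 𝓘(ℝ, ℝ) ∞ (fun x => B x (d x) (w x)) x₀) :
    SmoothSecAt n F d x₀ := by
  obtain ⟨U, hU, hx₀, k, s, hs, hfr⟩ := hW x₀
  have hs' : ∀ i, SmoothSecAt n F (s i) x₀ := fun i => (hs i).contMDiffAt (hU.mem_nhds hx₀)
  have hmem : ∀ x ∈ U, ∀ i, s i x ∈ W x := fun x hx i => by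
    rw [← (hfr x hx).2]
    exact Submodule.subset_span ⟨i, rfl⟩
  -- The Gram matrix of `B` in the local frame. It is smooth and invertible at `x₀`, so the frame
  -- coefficients of `d` are smooth once their images under it, the products of `d` with the frame,
  -- are.
  let ϕ : ∀ x, Trivial M (Fin k → ℝ) x →L[ℝ] Trivial M (Fin k → ℝ) x := fun x =>
    LinearMap.toContinuousLinearMap (E := Fin k → ℝ) (F' := Fin k → ℝ)
      (LinearMap.pi fun j => (B x).flip (s j x) ∘ₗ Fintype.linearCombination ℝ fun i => s i x)
  have hϕ_apply : ∀ x (c : Fin k → ℝ) j, ϕ x c j = B x (∑ i, c i • s i x) (s j x) :=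
    fun x c j => rfl
  have hsum : ∀ c : M → Fin k → ℝ, ContMDiffAt (𝓡 n) 𝓘(ℝ, Fin k → ℝ) ∞ c x₀ →
      SmoothSecAt n F (fun x => ∑ i, c x i • s i x) x₀ := fun c hc =>
    ContMDiffAt.sum_section fun i _ => ContMDiffAt.smul_section (f := fun x => c x i)
      (contMDiffAt_pi_space.1 hc i) (hs' i)
  have hϕ : ContMDiffAt (𝓡 n) ((𝓡 n).prod 𝓘(ℝ, (Fin k → ℝ) →L[ℝ] (Fin k → ℝ))) ∞
      (fun x => TotalSpace.mk' ((Fin k → ℝ) →L[ℝ] (Fin k → ℝ)) x (ϕ x)) x₀ := by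
    refine contMDiffAt_hom_of_apply (E₁ := Trivial M (Fin k → ℝ)) (E₂ := Trivial M (Fin k → ℝ))
      fun v hv => ?_
    rw [contMDiffAt_totalSpace] at hv ⊢
    exact ⟨contMDiffAt_id, contMDiffAt_pi_space.2 fun j => hBs _ _ (hsum _ hv.2) (hs' j)⟩
  have hϕi : Function.Injective (ϕ x₀ : (Fin k → ℝ) →ₗ[ℝ] (Fin k → ℝ)) := by
    rw [← LinearMap.ker_eq_bot, LinearMap.ker_eq_bot']
    intro c hc
    refine funext (Fintype.linearIndependent_iff.1 (hfr x₀ hx₀).1 c (hB _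
      (Submodule.sum_mem _ fun i _ => Submodule.smul_mem _ _ (hmem x₀ hx₀ i)) fun w' hw' => ?_))
    rw [← (hfr x₀ hx₀).2] at hw'
    obtain ⟨c', rfl⟩ := (Submodule.mem_span_range_iff_exists_fun ℝ).1 hw'
    rw [_root_.map_sum]
    refine Finset.sum_eq_zero fun j _ => ?_
    rw [map_smul, ← hϕ_apply x₀ c j]
    have : ϕ x₀ c j = 0 := congrFun hc j
    rw [this, smul_zero]
  have hϕb : Function.Bijective (ϕ x₀) := ⟨hϕi, LinearMap.injective_iff_surjective.1 hϕi⟩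
  have hc : ∀ x, ∃ c : Fin k → ℝ, x ∈ U → ∑ i, c i • s i x = d x := fun x => by
    by_cases hx : x ∈ U
    · have : d x ∈ Submodule.span ℝ (range fun i => s i x) := by
        rw [(hfr x hx).2]; exact hd x
      obtain ⟨c, hc⟩ := (Submodule.mem_span_range_iff_exists_fun ℝ).1 this
      exact ⟨c, fun _ => hc⟩
    · exact ⟨0, fun h => absurd h hx⟩
  choose c hc using hc
  have hcs := contMDiffAt_of_hom_apply (E₁ := Trivial M (Fin k → ℝ))
    (E₂ := Trivial M (Fin k → ℝ)) hϕ hϕb (v := c) (by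
      rw [contMDiffAt_totalSpace]
      refine ⟨contMDiffAt_id, contMDiffAt_pi_space.2 fun j => ?_⟩
      refine (h (s j) (hs' j) ?_).congr_of_eventuallyEq ?_
      · filter_upwards [hU.mem_nhds hx₀] with x hx using hmem x hx j
      · filter_upwards [hU.mem_nhds hx₀] with x hx
        exact (hϕ_apply x (c x) j).trans (by rw [hc x hx]))
  rw [contMDiffAt_totalSpace] at hcs
  refine (hsum c hcs.2).congr_of_eventuallyEq ?_
  filter_upwards [hU.mem_nhds hx₀] with x hx
  rw [hc x hx]

/-- The images of a smooth family of projections of constant rank form a subbundle. -/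
theorem isSubbundle_of_projection {W : ∀ x, Submodule ℝ (E x)} {m : ℕ}
    (hm : ∀ x, finrank ℝ (W x) = m) (Q : ∀ x, E x →ₗ[ℝ] E x)
    (hQs : ∀ (x₀ : M) (z : ∀ x, E x), SmoothSecAt n F z x₀ →
      SmoothSecAt n F (fun x => Q x (z x)) x₀)
    (hQ : ∀ x z, Q x z ∈ W x) (hQW : ∀ x, ∀ w ∈ W x, Q x w = w) : IsSubbundle n F W := by
  intro x₀
  have hfd : ∀ x, FiniteDimensional ℝ (E x) := fun x =>
    VectorBundle.finiteDimensional ℝ F E x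
  let b := Module.finBasisOfFinrankEq ℝ (W x₀) (hm x₀)
  -- A basis of `W x₀`, extended locally and projected by `Q`, stays in `W` and remains independent
  -- near `x₀`; constant rank then makes it a frame.
  let z : Fin m → ∀ x, E x := fun i => FiberBundle.extend F (b i : E x₀)
  have hz : ∀ i, ∀ᶠ x in 𝓝 x₀, SmoothSecAt n F (z i) x := fun i => by
    obtain ⟨s, hs, hss⟩ := FiberBundle.exists_contMDiffOn_extend (k := ∞) (𝓡 n) F (b i : E x₀)
    filter_upwards [eventually_mem_nhds_iff.2 hs] with x hx using hss.contMDiffAt hx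
  let s : Fin m → ∀ x, E x := fun i x => Q x (z i x)
  have hs : ∀ i, ∀ᶠ x in 𝓝 x₀, SmoothSecAt n F (s i) x := fun i =>
    (hz i).mono fun x hx => hQs x _ hx
  have hs₀ : ∀ i, s i x₀ = b i := fun i => by
    simp only [s, z, FiberBundle.extend_apply_self]
    exact hQW x₀ _ (b i).2
  let e := trivializationAt F E x₀
  have hli : ∀ᶠ x in 𝓝 x₀, LinearIndependent ℝ (fun i => (e ⟨x, s i x⟩).2) := by
    have hcont : ContinuousAt (fun x i => (e ⟨x, s i x⟩).2) x₀ :=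
      continuousAt_pi.2 fun i => ((contMDiffAt_section x₀).1 (hs i).self_of_nhds).continuousAt
    refine hcont.eventually (LinearIndependent.eventually ?_)
    have hlin : LinearIndependent ℝ fun i => ((b i : W x₀) : E x₀) :=
      b.linearIndependent.map' (W x₀).subtype (Submodule.ker_subtype _)
    have := hlin.map' (e.linearEquivAt ℝ x₀ (mem_baseSet_trivializationAt F E x₀)).toLinearMap
      (LinearEquiv.ker _)
    convert! this using 1
    funext i
    change (e ⟨x₀, s i x₀⟩).2 = _
    rw [hs₀]
    rfl
  obtain ⟨U, hUs, hU, hx₀⟩ := eventually_nhds_iff.1 ((Filter.eventually_all.2 hs).and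
    (hli.and (e.open_baseSet.mem_nhds (mem_baseSet_trivializationAt F E x₀))))
  refine ⟨U, hU, hx₀, m, s, fun i x hx => ((hUs x hx).1 i).contMDiffWithinAt, fun x hx => ?_⟩
  obtain ⟨-, h1, h2⟩ := hUs x hx
  have hlin : LinearIndependent ℝ (fun i => s i x) :=
    LinearIndependent.of_comp (e.linearEquivAt ℝ x h2).toLinearMap h1
  refine ⟨hlin, Submodule.eq_of_le_of_finrank_eq ?_ ?_⟩
  · rw [Submodule.span_le]
    rintro _ ⟨i, rfl⟩
    exact hQ x _
  · rw [finrank_span_eq_card hlin, Fintype.card_fin, hm x]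

variable (n) in
/-- The action on sections of a smooth family of fibrewise linear maps. -/
def mapSec (A : ∀ x, E x →ₗ[ℝ] E x)
    (hA : ∀ (x₀ : M) (z : ∀ x, E x), SmoothSecAt n F z x₀ →
      SmoothSecAt n F (fun x => A x (z x)) x₀) :
    Sec n F E →ₗ[C^∞⟮𝓡 n, M; ℝ⟯] Sec n F E where
  toFun z := ⟨fun x => A x (z x), fun x => hA x _ (z.contMDiff x)⟩
  map_add' a b := by ext x; exact map_add (A x) (a x) (b x)
  map_smul' f a := by ext x; exact map_smul (A x) (f x) (a x)

end Subbundles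

namespace ExactCourantAlgebroid

variable {n : ℕ} {M : Type*} [TopologicalSpace M] [ChartedSpace (EuclideanSpace ℝ (Fin n)) M]
  [IsManifold (𝓡 n) ∞ M]
  {F : Type*} [NormedAddCommGroup F] [NormedSpace ℝ F] [FiniteDimensional ℝ F]
  {E : M → Type*} [∀ x, AddCommGroup (E x)] [∀ x, Module ℝ (E x)]
  [∀ x, TopologicalSpace (E x)] [∀ x, IsTopologicalAddGroup (E x)]
  [∀ x, ContinuousSMul ℝ (E x)] [TopologicalSpace (TotalSpace F E)] [FiberBundle F E]
  [VectorBundle ℝ F E] [ContMDiffVectorBundle ∞ F E (𝓡 n)]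
  {C : ExactCourantAlgebroid n F E}

theorem smoothAt_pairing (C : ExactCourantAlgebroid n F E) {x₀ : M} {a b : ∀ x, E x}
    (ha : SmoothSecAt n F a x₀) (hb : SmoothSecAt n F b x₀) :
    ContMDiffAt (𝓡 n) 𝓘(ℝ, ℝ) ∞ (fun x => C.pairing x (a x) (b x)) x₀ := by
  have := GeneralizedMetric.contMDiffAt_pairing (C := C) ha hb
  rw [contMDiffAt_totalSpace] at this
  exact this.2

/-! ### The orthogonal decomposition E = V ⊕ V^⊥ -/

namespace GeneralizedMetric

variable (V : C.GeneralizedMetric)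

theorem exists_proj (x : M) : ∃ q : E x →ₗ[ℝ] E x, ∀ z, q z ∈ V.fiber x ∧
    ∀ w ∈ V.fiber x, C.pairing x (q z) w = C.pairing x z w := by
  have : FiniteDimensional ℝ (E x) := VectorBundle.finiteDimensional ℝ F E x
  refine exists_linearMap_representing (V.fiber x) (C.pairing x).toLinearMap₁₂
    (C.pairing x).toLinearMap₁₂ fun w hw h => ?_
  by_contra hne
  exact (V.pos x w hw hne).ne' (h w hw)

/-- The orthogonal projection of `E` onto `V`. -/
def proj (x : M) : E x →ₗ[ℝ] E x := (V.exists_proj x).choose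

theorem proj_mem (x : M) (z : E x) : V.proj x z ∈ V.fiber x :=
  ((V.exists_proj x).choose_spec z).1

theorem pairing_proj {x : M} (z : E x) {w : E x} (hw : w ∈ V.fiber x) :
    C.pairing x (V.proj x z) w = C.pairing x z w :=
  ((V.exists_proj x).choose_spec z).2 w hw

theorem eq_of_pairing_eq {x : M} {a b : E x} (ha : a ∈ V.fiber x) (hb : b ∈ V.fiber x)
    (h : ∀ w ∈ V.fiber x, C.pairing x a w = C.pairing x b w) : a = b := by
  by_contra hne
  have hab := (V.fiber x).sub_mem ha hb
  have := V.pos x _ hab (sub_ne_zero.2 hne)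
  rw [map_sub (C.pairing x), _root_.sub_apply, h _ hab, sub_self] at this
  exact lt_irrefl _ this

theorem proj_of_mem {x : M} {z : E x} (hz : z ∈ V.fiber x) : V.proj x z = z :=
  V.eq_of_pairing_eq (V.proj_mem x z) hz fun _ hw => V.pairing_proj z hw

theorem smoothSecAt_proj (x₀ : M) (z : ∀ x, E x) (hz : SmoothSecAt n F z x₀) :
    SmoothSecAt n F (fun x => V.proj x (z x)) x₀ := by
  refine V.isSubbundle.smoothSecAt (B := fun x => (C.pairing x).toLinearMap₁₂)
    (fun a b ha hb => C.smoothAt_pairing ha hb) (fun w hw h => ?_) (fun x => V.proj_mem x _)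
    fun w hw hwV => (C.smoothAt_pairing hz hw).congr_of_eventuallyEq ?_
  · by_contra hne
    exact (V.pos x₀ w hw hne).ne' (h w hw)
  · filter_upwards [hwV] with x hx using V.pairing_proj _ hx

/-- The orthogonal projection of `E` onto `V^⊥`. -/
def coproj (x : M) : E x →ₗ[ℝ] E x := LinearMap.id - V.proj x

theorem coproj_apply (x : M) (z : E x) : V.coproj x z = z - V.proj x z := rfl

theorem proj_add_coproj (x : M) (z : E x) : V.proj x z + V.coproj x z = z := by
  rw [coproj_apply, add_sub_cancel]

theorem coproj_mem (x : M) (z : E x) : V.coproj x z ∈ C.orth V.fiber x := fun w hw => by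
  rw [coproj_apply, map_sub, _root_.sub_apply, V.pairing_proj z hw, sub_self]

theorem smoothSecAt_coproj (x₀ : M) (z : ∀ x, E x) (hz : SmoothSecAt n F z x₀) :
    SmoothSecAt n F (fun x => V.coproj x (z x)) x₀ :=
  ContMDiffAt.sub_section hz (V.smoothSecAt_proj x₀ z hz)

theorem proj_of_mem_orth {x : M} {z : E x} (hz : z ∈ C.orth V.fiber x) : V.proj x z = 0 :=
  V.eq_of_pairing_eq (V.proj_mem x z) (V.fiber x).zero_mem fun w hw => by
    rw [V.pairing_proj z hw, hz w hw, map_zero, _root_.zero_apply]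

theorem coproj_of_mem {x : M} {z : E x} (hz : z ∈ V.fiber x) : V.coproj x z = 0 := by
  rw [coproj_apply, V.proj_of_mem hz, sub_self]

theorem coproj_of_mem_orth {x : M} {z : E x} (hz : z ∈ C.orth V.fiber x) :
    V.coproj x z = z := by
  rw [coproj_apply, V.proj_of_mem_orth hz, sub_zero]

theorem pairing_eq_zero {x : M} {a b : E x} (ha : a ∈ V.fiber x) (hb : b ∈ C.orth V.fiber x) :
    C.pairing x a b = 0 := by
  rw [C.pairing_symm, hb a ha]

theorem pairing_proj_left (x : M) (a b : E x) :
    C.pairing x (V.proj x a) b = C.pairing x (V.proj x a) (V.proj x b) := by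
  conv_lhs => rw [← V.proj_add_coproj x b]
  rw [map_add, V.pairing_eq_zero (V.proj_mem x a) (V.coproj_mem x b), add_zero]

theorem pairing_coproj_left (x : M) (a b : E x) :
    C.pairing x (V.coproj x a) b = C.pairing x (V.coproj x a) (V.coproj x b) := by
  conv_lhs => rw [← V.proj_add_coproj x b]
  rw [map_add, V.coproj_mem x a _ (V.proj_mem x b), zero_add]

theorem pairing_proj_comm (x : M) (a b : E x) :
    C.pairing x (V.proj x a) b = C.pairing x a (V.proj x b) := by
  rw [V.pairing_proj_left, C.pairing_symm, ← V.pairing_proj_left, C.pairing_symm,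
    C.pairing_symm x a, V.pairing_proj_left, ← V.pairing_proj_left x b a, C.pairing_symm]

/-- The inverse `u ↦ u₋ = s(u) - ρ*(g u)` of the isomorphism `ρ : V^⊥ → TM`. -/
def lowerLift (x : M) : TangentSpace (𝓡 n) x →ₗ[ℝ] E x := V.splitting x - V.coLift x

theorem lift_eq (x : M) (u : TangentSpace (𝓡 n) x) :
    V.lift x u = V.splitting x u + V.coLift x u := by
  simp [splitting]

theorem lowerLift_apply (x : M) (u : TangentSpace (𝓡 n) x) :
    V.lowerLift x u = V.splitting x u - V.coLift x u := rfl

theorem anchor_coLift (x : M) (u : TangentSpace (𝓡 n) x) : C.anchor x (V.coLift x u) = 0 :=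
  (C.anchor_eq_zero_iff x _).2 ⟨V.metricAt x u, V.pairing_coLift x u⟩

theorem anchor_lowerLift (x : M) (u : TangentSpace (𝓡 n) x) :
    C.anchor x (V.lowerLift x u) = u := by
  rw [lowerLift_apply, map_sub, V.anchor_splitting, V.anchor_coLift, sub_zero]

theorem lowerLift_mem (x : M) (u : TangentSpace (𝓡 n) x) :
    V.lowerLift x u ∈ C.orth V.fiber x := fun w hw => by
  rw [← V.lift_anchor hw, V.lift_eq, lowerLift_apply]
  have h1 := V.pairing_coLift x (C.anchor x w) (V.splitting x u)
  rw [V.anchor_splitting] at h1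
  have h2 := V.metric.symm x u (C.anchor x w)
  change V.metricAt x _ _ = V.metricAt x _ _ at h2
  simp only [map_sub, map_add, _root_.sub_apply, V.pairing_splitting, V.pairing_coLift,
    V.anchor_splitting, V.anchor_coLift, C.pairing_symm x (V.splitting x u) (V.coLift x _), h2,
    map_zero]
  ring

theorem pairing_lowerLift (x : M) (u v : TangentSpace (𝓡 n) x) :
    C.pairing x (V.lowerLift x u) (V.lowerLift x v) = -2 * V.metricAt x u v := by
  have h := V.lowerLift_mem x u _ (V.lift_mem x v)
  have h1 : V.lowerLift x v = V.lift x v - (2 : ℝ) • V.coLift x v := by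
    rw [V.lift_eq, lowerLift_apply, two_smul]; abel
  rw [h1, map_sub, h, map_smul, C.pairing_symm, V.pairing_coLift, V.anchor_lowerLift]
  have h2 := V.metric.symm x u v
  change V.metricAt x _ _ = V.metricAt x _ _ at h2
  rw [h2, smul_eq_mul]
  ring

/-- The difference of the two sides lies in ker ρ ∩ V^⊥. By exactness its pairing with any b depends
only on ρ(b), so b may be replaced by a vector of V with the same anchor, where the pairing
vanishes. -/
theorem lowerLift_anchor {x : M} {z : E x} (hz : z ∈ C.orth V.fiber x) :
    V.lowerLift x (C.anchor x z) = z := by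
  rw [← sub_eq_zero]
  set y := V.lowerLift x (C.anchor x z) - z with hy
  have hy0 : C.anchor x y = 0 := by rw [hy, map_sub, V.anchor_lowerLift, sub_self]
  have hyV : y ∈ C.orth V.fiber x := Submodule.sub_mem _ (V.lowerLift_mem x _) hz
  obtain ⟨ξ, hξ⟩ := (C.anchor_eq_zero_iff x y).1 hy0
  refine C.pairing_nondegenerate x y fun b => ?_
  rw [hξ, ← V.anchor_lift x (C.anchor x b), ← hξ, hyV _ (V.lift_mem x _)]

/-- Every element of V^⊥ is some u₋, and ⟨u₋, u₋⟩ = -2 g(u, u). -/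
theorem pairing_self_neg {x : M} {z : E x} (hz : z ∈ C.orth V.fiber x) (h0 : z ≠ 0) :
    C.pairing x z z < 0 := by
  rw [← V.lowerLift_anchor hz, pairing_lowerLift]
  have : C.anchor x z ≠ 0 := fun h => h0 (by rw [← V.lowerLift_anchor hz, h, map_zero])
  have := V.metricAt_pos x _ this
  linarith

/-- `u₊` as a section of `E`, for a vector field `u`. -/
def liftSec (u : VF n M) : Sec n F E :=
  ⟨fun x => V.lift x (u x), fun x => V.contMDiffAt_lift (u.contMDiff x)⟩

/-- `u₋` as a section of `E`, for a vector field `u`. -/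
def lowerLiftSec (u : VF n M) : Sec n F E :=
  ⟨fun x => V.lowerLift x (u x), fun x =>
    ((V.splittingSec u).contMDiff x).sub_section (V.contMDiffAt_coLift (u.contMDiff x))⟩

/-- `ρ* (g u)` as a section of `E`, for a vector field `u`. -/
def coLiftSec (u : VF n M) : Sec n F E :=
  ⟨fun x => V.coLift x (u x), fun x => V.contMDiffAt_coLift (u.contMDiff x)⟩

end GeneralizedMetric

/-! ### The inner product on D and the bundle V_D -/

namespace SmallDirac

variable (D : C.SmallDirac) (V : C.GeneralizedMetric)

/-- Since ⟨d₊, d⟩ = ⟨d₊, d₊⟩, positivity on V forces d₊ = 0. Then d is an isotropic vector of the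
negative definite V^⊥. Thus ⟨d₊, d'⟩ is definite on D although the pairing itself is zero there. -/
theorem eq_zero_of_mem_inf {x : M} {d : E x} (hd : d ∈ D.fiber x)
    (h : C.pairing x (V.proj x d) d = 0) : d = 0 := by
  have h0 : V.proj x d = 0 := by
    by_contra hne
    rw [V.pairing_proj_left] at h
    exact (V.pos x _ (V.proj_mem x d) hne).ne' h
  have h1 : d ∈ C.orth V.fiber x := by
    rw [← V.proj_add_coproj x d, h0, zero_add]
    exact V.coproj_mem x d
  by_contra hne
  exact (V.pairing_self_neg h1 hne).ne (D.isotropic x d hd d hd)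

theorem exists_riesz (x : M) : ∃ q : E x →ₗ[ℝ] E x, ∀ z, q z ∈ D.fiber x ∧
    ∀ w ∈ D.fiber x, C.pairing x (V.proj x (q z)) w = C.pairing x z w := by
  have : FiniteDimensional ℝ (E x) := VectorBundle.finiteDimensional ℝ F E x
  exact exists_linearMap_representing (D.fiber x) ((C.pairing x).toLinearMap₁₂ ∘ₗ V.proj x)
    (C.pairing x).toLinearMap₁₂ fun w hw h => D.eq_zero_of_mem_inf V hw (h w hw)

/-- The map `E → D` with `⟨(riesz z)₊, d⟩ = ⟨z, d⟩` for all `d ∈ D`; its kernel is `D^⊥`. -/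
def riesz (x : M) : E x →ₗ[ℝ] E x := (D.exists_riesz V x).choose

theorem riesz_mem (x : M) (z : E x) : D.riesz V x z ∈ D.fiber x :=
  ((D.exists_riesz V x).choose_spec z).1

theorem pairing_proj_riesz {x : M} (z : E x) {d : E x} (hd : d ∈ D.fiber x) :
    C.pairing x (V.proj x (D.riesz V x z)) d = C.pairing x z d :=
  ((D.exists_riesz V x).choose_spec z).2 d hd

theorem eq_of_pairing_proj_eq {x : M} {a b : E x} (ha : a ∈ D.fiber x) (hb : b ∈ D.fiber x)
    (h : ∀ d ∈ D.fiber x, C.pairing x (V.proj x a) d = C.pairing x (V.proj x b) d) : a = b := by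
  rw [← sub_eq_zero]
  have hab := (D.fiber x).sub_mem ha hb
  refine D.eq_zero_of_mem_inf V hab ?_
  rw [map_sub (V.proj x), map_sub (C.pairing x), _root_.sub_apply, h _ hab, sub_self]

theorem smoothSecAt_riesz (x₀ : M) (z : ∀ x, E x) (hz : SmoothSecAt n F z x₀) :
    SmoothSecAt n F (fun x => D.riesz V x (z x)) x₀ := by
  refine D.isSubbundle.smoothSecAt (B := fun x => (C.pairing x).toLinearMap₁₂ ∘ₗ V.proj x)
    (fun a b ha hb => C.smoothAt_pairing (V.smoothSecAt_proj x₀ a ha) hb)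
    (fun w hw h => D.eq_zero_of_mem_inf V hw (h w hw)) (fun x => D.riesz_mem V x _)
    fun w hw hwV => (C.smoothAt_pairing hz hw).congr_of_eventuallyEq ?_
  filter_upwards [hwV] with x hx using D.pairing_proj_riesz V _ hx

theorem riesz_proj_of_mem {x : M} {d : E x} (hd : d ∈ D.fiber x) :
    D.riesz V x (V.proj x d) = d :=
  D.eq_of_pairing_proj_eq V (D.riesz_mem V x _) hd fun _ hb => D.pairing_proj_riesz V _ hb

theorem riesz_eq_zero_iff {x : M} {z : E x} :
    D.riesz V x z = 0 ↔ z ∈ C.orth D.fiber x := by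
  refine ⟨fun h w hw => ?_, fun h => ?_⟩
  · rw [← D.pairing_proj_riesz V z hw, h, map_zero, map_zero, _root_.zero_apply]
  · refine D.eq_of_pairing_proj_eq V (D.riesz_mem V x z) (D.fiber x).zero_mem fun d hd => ?_
    rw [D.pairing_proj_riesz V z hd, h d hd, map_zero, map_zero, _root_.zero_apply]

theorem riesz_of_mem {x : M} {d : E x} (hd : d ∈ D.fiber x) : D.riesz V x d = 0 :=
  (D.riesz_eq_zero_iff V).2 fun w hw => D.isotropic x d hd w hw

/-- Isotropy gives `riesz d = 0`, so d₊ and d₋ have opposite images. This is the source of the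
opposite signs in `upperPerp` and `lowerPerp`, and in the two connections below. -/
theorem riesz_coproj_of_mem {x : M} {d : E x} (hd : d ∈ D.fiber x) :
    D.riesz V x (V.coproj x d) = -d := by
  rw [V.coproj_apply, map_sub, D.riesz_of_mem V hd, D.riesz_proj_of_mem V hd, zero_sub]

/-- `z - (riesz z)₊`, which maps `V` to `V ∩ D^⊥`. -/
def upperPerp (x : M) : E x →ₗ[ℝ] E x := LinearMap.id - V.proj x ∘ₗ D.riesz V x

/-- `z + (riesz z)₋`, which maps `V^⊥` to `V^⊥ ∩ D^⊥`. -/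
def lowerPerp (x : M) : E x →ₗ[ℝ] E x := LinearMap.id + V.coproj x ∘ₗ D.riesz V x

theorem upperPerp_apply (x : M) (z : E x) :
    D.upperPerp V x z = z - V.proj x (D.riesz V x z) := rfl

theorem lowerPerp_apply (x : M) (z : E x) :
    D.lowerPerp V x z = z + V.coproj x (D.riesz V x z) := rfl

theorem smoothSecAt_upperPerp (x₀ : M) (z : ∀ x, E x) (hz : SmoothSecAt n F z x₀) :
    SmoothSecAt n F (fun x => D.upperPerp V x (z x)) x₀ :=
  ContMDiffAt.sub_section hz (V.smoothSecAt_proj x₀ _ (D.smoothSecAt_riesz V x₀ z hz))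

theorem smoothSecAt_lowerPerp (x₀ : M) (z : ∀ x, E x) (hz : SmoothSecAt n F z x₀) :
    SmoothSecAt n F (fun x => D.lowerPerp V x (z x)) x₀ :=
  ContMDiffAt.add_section hz (V.smoothSecAt_coproj x₀ _ (D.smoothSecAt_riesz V x₀ z hz))

theorem upperPerp_mem_orth (x : M) (z : E x) : D.upperPerp V x z ∈ C.orth D.fiber x := by
  rw [← D.riesz_eq_zero_iff V, upperPerp_apply, map_sub,
    D.riesz_proj_of_mem V (D.riesz_mem V x z), sub_self]

theorem lowerPerp_mem_orth (x : M) (z : E x) : D.lowerPerp V x z ∈ C.orth D.fiber x := by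
  rw [← D.riesz_eq_zero_iff V, lowerPerp_apply, map_add,
    D.riesz_coproj_of_mem V (D.riesz_mem V x z), add_neg_cancel]

theorem upperPerp_mem {x : M} {z : E x} (hz : z ∈ V.fiber x) :
    D.upperPerp V x z ∈ V.fiber x :=
  Submodule.sub_mem _ hz (V.proj_mem x _)

theorem lowerPerp_mem {x : M} {z : E x} (hz : z ∈ C.orth V.fiber x) :
    D.lowerPerp V x z ∈ C.orth V.fiber x :=
  Submodule.add_mem _ hz (V.coproj_mem x _)

/-- The projection `z ↦ z₊ + (riesz z₊)₋` of `E` onto `V_D`, with kernel `V^⊥`. -/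
def transverseProj (x : M) : E x →ₗ[ℝ] E x := D.lowerPerp V x ∘ₗ V.proj x

theorem transverseProj_mem (x : M) (z : E x) :
    D.transverseProj V x z ∈ transverseOf V D x := by
  -- With d = riesz z₊, the vector z₊ + d₋ equals d + (z₊ - d₊): an element of D plus one of V ∩
  -- D^⊥.
  have h : D.transverseProj V x z = D.riesz V x (V.proj x z) + D.upperPerp V x (V.proj x z) := by
    change D.lowerPerp V x _ = _
    rw [lowerPerp_apply, upperPerp_apply, V.coproj_apply]
    abel
  rw [h]
  exact Submodule.add_mem_sup (D.riesz_mem V x _)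
    ⟨D.upperPerp_mem_orth V x _, D.upperPerp_mem V (V.proj_mem x z)⟩

theorem transverseProj_of_mem {x : M} {w : E x} (hw : w ∈ transverseOf V D x) :
    D.transverseProj V x w = w := by
  obtain ⟨d, hd, y, hy, rfl⟩ := Submodule.mem_sup.1 hw
  change D.lowerPerp V x _ = _
  rw [lowerPerp_apply, map_add, map_add, D.riesz_proj_of_mem V hd, V.proj_of_mem hy.2,
    (D.riesz_eq_zero_iff V).2 hy.1, add_zero, V.coproj_apply]
  abel

/-- V_D is a graph over V: `proj` and `transverseProj` restrict to mutually inverse maps between V_D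
and V. -/
theorem finrank_transverseOf (x : M) : finrank ℝ (transverseOf V D x) = n := by
  refine (LinearEquiv.finrank_eq (LinearEquiv.ofLinearMap
    ((V.proj x).domRestrict _ |>.codRestrict (V.fiber x) fun w => V.proj_mem x _)
    ((D.transverseProj V x).domRestrict _ |>.codRestrict (transverseOf V D x)
      fun w => D.transverseProj_mem V x _) ?_ ?_)).trans (V.finrank_eq x)
  · ext ⟨z, hz⟩
    change V.proj x (D.lowerPerp V x (V.proj x z)) = z
    rw [V.proj_of_mem hz, lowerPerp_apply, map_add, V.proj_of_mem hz,
      V.proj_of_mem_orth (V.coproj_mem x _), add_zero]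
  · ext ⟨w, hw⟩
    change D.lowerPerp V x (V.proj x (V.proj x w)) = w
    rw [V.proj_of_mem (V.proj_mem x w)]
    exact D.transverseProj_of_mem V hw

theorem isSubbundle_transverseOf : IsSubbundle n F (transverseOf V D) :=
  isSubbundle_of_projection (D.finrank_transverseOf V) (D.transverseProj V)
    (fun x₀ z hz => D.smoothSecAt_lowerPerp V x₀ _ (V.smoothSecAt_proj x₀ z hz))
    (D.transverseProj_mem V) fun _ _ hw => D.transverseProj_of_mem V hw

theorem transverseOf_le_orth (x : M) : transverseOf V D x ≤ C.orth D.fiber x :=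
  sup_le (fun d hd w hw => D.isotropic x d hd w hw) inf_le_left

/-- For w = d + y with d ∈ D and y ∈ D^⊥ ∩ V, all terms but ⟨y, y⟩ vanish. -/
theorem pos_of_mem_transverseOf {x : M} {w : E x} (hw : w ∈ transverseOf V D x)
    (hwD : w ∉ D.fiber x) : 0 < C.pairing x w w := by
  obtain ⟨d, hd, y, hy, rfl⟩ := Submodule.mem_sup.1 hw
  have hy0 : y ≠ 0 := fun h => hwD (by rwa [h, add_zero])
  rw [map_add, map_add, _root_.add_apply, _root_.add_apply, D.isotropic x d hd d hd,
    hy.1 d hd, C.pairing_symm x d y, hy.1 d hd, zero_add, zero_add, zero_add]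
  exact V.pos x y hy.2 hy0

theorem pairing_eq_zero_of_mem_transverseOf {x : M} {w z : E x}
    (hw : w ∈ transverseOf V D x) (hz : z ∈ C.orth D.fiber x) (hz' : z ∈ C.orth V.fiber x) :
    C.pairing x w z = 0 := by
  obtain ⟨d, hd, y, hy, rfl⟩ := Submodule.mem_sup.1 hw
  rw [C.pairing_symm, map_add, hz d hd, hz' y hy.2, add_zero]

/-- On D^⊥ the map `lowerPerp` is the identity, so z is the sum of the images of z₊ and z₋; the
first is in V_D and the second vanishes by assumption. -/
theorem mem_transverseOf {x : M} {z : E x} (hz : z ∈ C.orth D.fiber x)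
    (h : D.lowerPerp V x (V.coproj x z) = 0) : z ∈ transverseOf V D x := by
  have : z = D.transverseProj V x z := by
    have h1 : D.lowerPerp V x z = z := by
      rw [lowerPerp_apply, (D.riesz_eq_zero_iff V).2 hz, map_zero, add_zero]
    change z = D.lowerPerp V x (V.proj x z)
    conv_lhs => rw [← h1, ← V.proj_add_coproj x z, map_add, h, add_zero]
  rw [this]
  exact D.transverseProj_mem V x z

end SmallDirac

/-! ### Bracket calculus in the splitting defined by V -/

theorem lieDer_zero_fun (X : ∀ x : M, TangentSpace (𝓡 n) x) (x : M) :
    lieDer X (fun _ => 0) x = 0 := by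
  simp [lieDer, mvfderiv]

theorem pairing_of_anchor_eq_zero (C : ExactCourantAlgebroid n F E) {x : M} {a b : E x}
    (ha : C.anchor x a = 0) (hb : C.anchor x b = 0) : C.pairing x a b = 0 := by
  obtain ⟨ξ, hξ⟩ := (C.anchor_eq_zero_iff x a).1 ha
  rw [hξ, hb, map_zero]

namespace GeneralizedMetric

variable (V : C.GeneralizedMetric)

/-- The projection `Γ(E) → Γ(V)`. -/
def projSec : Sec n F E →ₗ[C^∞⟮𝓡 n, M; ℝ⟯] Sec n F E := mapSec n V.proj V.smoothSecAt_proj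

/-- The projection `Γ(E) → Γ(V^⊥)`. -/
def coprojSec : Sec n F E →ₗ[C^∞⟮𝓡 n, M; ℝ⟯] Sec n F E := mapSec n V.coproj V.smoothSecAt_coproj

/-- Testing against the global sections z₊ and z₋ suffices, by definiteness on V and V^⊥; no vector
of the fibre has to be extended to a section. -/
theorem eq_zero_of_pairing_sec (V : C.GeneralizedMetric) {z : Sec n F E} {x : M}
    (h : ∀ c : Sec n F E, C.pairing x (z x) (c x) = 0) : z x = 0 := by
  have h1 : V.proj x (z x) = 0 := by
    by_contra hne
    have : C.pairing x (z x) (V.proj x (z x)) = 0 := h (V.projSec z)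
    rw [C.pairing_symm, V.pairing_proj_left] at this
    exact (V.pos x _ (V.proj_mem x _) hne).ne' this
  have h2 : V.coproj x (z x) = 0 := by
    by_contra hne
    have : C.pairing x (z x) (V.coproj x (z x)) = 0 := h (V.coprojSec z)
    rw [C.pairing_symm, V.pairing_coproj_left] at this
    exact (V.pairing_self_neg (V.coproj_mem x _) hne).ne this
  rw [← V.proj_add_coproj x (z x), h1, h2, add_zero]

/-- The Dorfman bracket is skew on orthogonal sections. -/
theorem bracket_swap_of_orth (V : C.GeneralizedMetric) {a b : Sec n F E}
    (h : ∀ x, C.pairing x (a x) (b x) = 0) :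
    C.bracket a b = -C.bracket b a := by
  rw [eq_neg_iff_add_eq_zero]
  ext x
  refine V.eq_zero_of_pairing_sec fun c => ?_
  have := C.bracket_add_swap a b c x
  rwa [show (fun y => C.pairing y (a y) (b y)) = fun _ => 0 from funext h, lieDer_zero_fun] at this

/-- Orthogonality removes the term with the derivative of ⟨a, b⟩ from the Leibniz rule in the first
argument. -/
theorem bracket_smul_left_of_orth (V : C.GeneralizedMetric) {a b : Sec n F E}
    (h : ∀ x, C.pairing x (a x) (b x) = 0)
    (f : C^∞⟮𝓡 n, M; ℝ⟯) (x : M) : C.bracket (f • a) b x =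
      f x • C.bracket a b x - lieDer (fun y => C.anchor y (b y)) f x • a x := by
  have h' : ∀ x, C.pairing x ((f • a) x) (b x) = 0 := fun x => by
    rw [smul_sec_apply, map_smul, _root_.smul_apply, h, smul_zero]
  rw [V.bracket_swap_of_orth h', V.bracket_swap_of_orth h]
  change -C.bracket b (f • a) x = f x • -C.bracket b a x - _
  rw [C.bracket_smul, smul_neg, neg_add, ← sub_eq_add_neg]

/-- With e = s(X) + ρ*α, the right side is (L_X g)(u, v) - dα(u, v) + H(X, u, v), written out by the
formulas for the Lie and exterior derivatives. -/
theorem pairing_bracket_liftSec_lowerLiftSec (e : Sec n F E) (u v : VF n M) (x : M) :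
    C.pairing x (C.bracket e (V.liftSec u) x) (V.lowerLiftSec v x) =
      lieDer (C.anchorSec e) (fun y => V.metric.inner y (u y) (v y)) x
        - V.metric.inner x (u x) (VectorField.mlieBracket (𝓡 n) (C.anchorSec e) v x)
        - V.metric.inner x (v x) (VectorField.mlieBracket (𝓡 n) (C.anchorSec e) u x)
        - lieDer u (fun y => C.pairing y (e y) (V.splitting y (v y))) x
        + lieDer v (fun y => C.pairing y (e y) (V.splitting y (u y))) x
        + C.pairing x (e x) (V.splitting x (VectorField.mlieBracket (𝓡 n) u v x))
        + V.threeForm (C.anchorSec e) u v x := by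
  set X := C.anchorSec e with hX
  -- The component ρ*α of `e`. It lies in ker ρ and has the same pairings with s(w) as `e`, since
  -- the splitting is isotropic.
  set k : Sec n F E := e - V.splittingSec X with hk
  have hek : e = V.splittingSec X + k := by rw [hk]; abel
  have hk0 : ∀ y, C.anchor y (k y) = 0 := fun y => by
    change C.anchor y (e y - V.splitting y (C.anchor y (e y))) = 0
    rw [map_sub, V.anchor_splitting, sub_self]
  have hsp : ∀ (w : VF n M), (fun y => C.anchor y (V.splittingSec w y)) = w := fun w =>
    funext fun y => V.anchor_splitting y _
  have hke : ∀ y (w : TangentSpace (𝓡 n) y),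
      C.pairing y (k y) (V.splitting y w) = C.pairing y (e y) (V.splitting y w) := fun y w => by
    change C.pairing y (e y - V.splitting y _) _ = _
    rw [map_sub, _root_.sub_apply, V.pairing_splitting, sub_zero]
  have hu : V.liftSec u = V.splittingSec u + V.coLiftSec u := by
    ext y; exact V.lift_eq y (u y)
  have hco : ∀ (w : VF n M) y, V.coLiftSec w y = V.coLift y (w y) := fun _ _ => rfl
  have hspa : ∀ (w : VF n M) y, V.splittingSec w y = V.splitting y (w y) := fun _ _ => rfl
  -- the bracket with the `T*M`-component of `u₊`
  have hA0 : C.anchor x (C.bracket e (V.coLiftSec u) x) = 0 := by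
    rw [C.anchor_bracket]
    have : (fun y => C.anchor y (V.coLiftSec u y)) = 0 := funext fun y => V.anchor_coLift y _
    rw [this, VectorField.mlieBracket_zero_right]
    rfl
  have hA : C.pairing x (C.bracket e (V.coLiftSec u) x) (V.splittingSec v x) =
      lieDer X (fun y => V.metric.inner y (u y) (v y)) x
        - V.metric.inner x (u x) (VectorField.mlieBracket (𝓡 n) X v x) := by
    have h := C.lieDer_pairing e (V.coLiftSec u) (V.splittingSec v) x
    have h1 : (fun y => C.pairing y (V.coLiftSec u y) (V.splittingSec v y)) =
        fun y => V.metric.inner y (u y) (v y) := funext fun y => by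
      rw [hco, V.pairing_coLift, hspa, V.anchor_splitting]; rfl
    have h2 : C.pairing x (V.coLiftSec u x) (C.bracket e (V.splittingSec v) x) =
        V.metric.inner x (u x) (VectorField.mlieBracket (𝓡 n) X v x) := by
      rw [hco, V.pairing_coLift, C.anchor_bracket, hsp]; rfl
    rw [h1, h2] at h
    have h3 : (fun y => C.anchor y (e y)) = X := rfl
    rw [h3] at h
    linarith
  have hB : C.pairing x (C.bracket e (V.splittingSec u) x) (V.coLiftSec v x) =
      V.metric.inner x (v x) (VectorField.mlieBracket (𝓡 n) X u x) := by
    rw [C.pairing_symm, hco, V.pairing_coLift, C.anchor_bracket, hsp]; rfl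
  -- The right side is -dα(u, v): the symmetric part of the bracket contributes the derivative along
  -- v, and invariance of the pairing under s(u) contributes the rest.
  have hK : C.pairing x (C.bracket k (V.splittingSec u) x) (V.splittingSec v x) =
      lieDer v (fun y => C.pairing y (e y) (V.splitting y (u y))) x
        - lieDer u (fun y => C.pairing y (e y) (V.splitting y (v y))) x
        + C.pairing x (e x) (V.splitting x (VectorField.mlieBracket (𝓡 n) u v x)) := by
    have h1 := C.bracket_add_swap k (V.splittingSec u) (V.splittingSec v) x
    have h2 := C.lieDer_pairing (V.splittingSec u) k (V.splittingSec v) x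
    rw [hsp] at h1 h2
    simp only [hspa, hke] at h1 h2
    have h3 : C.pairing x (k x) (C.bracket (V.splittingSec u) (V.splittingSec v) x) =
        C.pairing x (e x) (V.splitting x (VectorField.mlieBracket (𝓡 n) u v x)) := by
      obtain ⟨ξ, hξ⟩ := (C.anchor_eq_zero_iff x (k x)).1 (hk0 x)
      rw [← hke, hξ, hξ, C.anchor_bracket, hsp, hsp, V.anchor_splitting]
    rw [h3] at h2
    rw [map_add, _root_.add_apply] at h1
    rw [hspa v]
    linarith
  have hH : C.pairing x (C.bracket (V.splittingSec X) (V.splittingSec u) x) (V.splittingSec v x) =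
      V.threeForm X u v x := rfl
  have hBr : C.bracket e (V.liftSec u) x = C.bracket e (V.splittingSec u) x
      + C.bracket e (V.coLiftSec u) x := by rw [hu, map_add]; rfl
  have hBk : C.bracket e (V.splittingSec u) x = C.bracket (V.splittingSec X) (V.splittingSec u) x
      + C.bracket k (V.splittingSec u) x := by
    conv_lhs => rw [hek]
    rw [map_add]; rfl
  have hv : V.lowerLiftSec v x = V.splittingSec v x - V.coLiftSec v x := rfl
  have hcc : C.pairing x (C.bracket e (V.coLiftSec u) x) (V.coLiftSec v x) = 0 :=
    C.pairing_of_anchor_eq_zero hA0 (V.anchor_coLift x _)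
  rw [hBr, hv, map_add, map_sub, _root_.add_apply, _root_.add_apply, hA, hcc, hB, hBk, map_add,
    _root_.add_apply, hH, hK]
  ring

/-- Invariance of the pairing under s(X), applied to ⟨s(u), s(v)⟩ = 0. -/
theorem threeForm_swap (X u v : VF n M) (x : M) :
    V.threeForm X v u x = -V.threeForm X u v x := by
  have h := C.lieDer_pairing (V.splittingSec X) (V.splittingSec u) (V.splittingSec v) x
  have h0 : (fun y => C.pairing y (V.splittingSec u y) (V.splittingSec v y)) = fun _ => 0 :=
    funext fun y => V.pairing_splitting y _ _
  rw [h0, lieDer_zero_fun] at h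
  rw [C.pairing_symm x (V.splittingSec u x)] at h
  change 0 = V.threeForm X u v x + V.threeForm X v u x at h
  linarith

end GeneralizedMetric

/-! ### The compatibility equations as a single tensor -/

namespace SmallDirac

variable {D : C.SmallDirac} {V : C.GeneralizedMetric}

/-- For `∇± = ∇ ± φ`, the tensor `⟨[e, u₊], v₋⟩ - ⟨∇⁺_v e, u₊⟩ + ⟨∇⁻_u e, v₋⟩` combines the
symmetric and antisymmetric compatibility expressions. -/
theorem pairing_bracket_sub_eq_symPart_sub_altPart (nablaPlus nablaMinus nabla : D.Connection)
    (φ : D.EndForm) (hp : ∀ X e, nablaPlus X e = nabla X e + φ X e)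
    (hm : ∀ X e, nablaMinus X e = nabla X e - φ X e) (e : D.Sections) (u v : VF n M) (x : M) :
    C.pairing x (C.bracket e.1 (V.liftSec u) x) (V.lowerLiftSec v x)
        - C.pairing x ((nablaPlus v e).1 x) (V.liftSec u x)
        + C.pairing x ((nablaMinus u e).1 x) (V.lowerLiftSec v x) =
      2 * symPart (fun u v x => nabla.extend V.metric (D.rhoBar V) e u v x
          - EndForm.dual φ (D.alpha V) e u v x) u v x
        - 2 * altPart (fun u v x => nabla.extend V.metric (D.alpha V) e u v x
          - EndForm.dual φ (D.rhoBar V) e u v x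
          - (1 / 2) * V.threeForm (C.anchorSec e.1) u v x) u v x := by
  have halpha : ∀ (d : D.Sections) y (w : TangentSpace (𝓡 n) y),
      D.alpha V y (D.fiberVal d y) w = C.pairing y (d.1 y) (V.splitting y w) := fun _ _ _ => rfl
  have hrho : ∀ (d : D.Sections) y (w : TangentSpace (𝓡 n) y),
      D.rhoBar V y (D.fiberVal d y) w = V.metric.inner y (C.anchor y (d.1 y)) w :=
    fun _ _ _ => rfl
  have hplus : ∀ (d : D.Sections) (w : VF n M),
      C.pairing x (d.1 x) (V.liftSec w x) = C.pairing x (d.1 x) (V.splitting x (w x))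
        + V.metric.inner x (C.anchor x (d.1 x)) (w x) := fun d w => by
    change C.pairing x (d.1 x) (V.lift x (w x)) = _
    rw [V.lift_eq, map_add, C.pairing_symm x (d.1 x) (V.coLift x (w x)), V.pairing_coLift,
      V.metric.symm]
    rfl
  have hminus : ∀ (d : D.Sections) (w : VF n M),
      C.pairing x (d.1 x) (V.lowerLiftSec w x) = C.pairing x (d.1 x) (V.splitting x (w x))
        - V.metric.inner x (C.anchor x (d.1 x)) (w x) := fun d w => by
    change C.pairing x (d.1 x) (V.lowerLift x (w x)) = _
    rw [V.lowerLift_apply, map_sub, C.pairing_symm x (d.1 x) (V.coLift x (w x)),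
      V.pairing_coLift, V.metric.symm]
    rfl
  have hadd : ∀ (d d' : D.Sections), (d + d').1 x = d.1 x + d'.1 x := fun _ _ => rfl
  have hsub : ∀ (d d' : D.Sections), (d - d').1 x = d.1 x - d'.1 x := fun _ _ => rfl
  set X := C.anchorSec e.1 with hX
  -- The Levi-Civita terms of (1) are g(X, ∇_u v) and g(X, ∇_v u). Koszul's formula tested against X
  -- expresses them through the derivatives and brackets in L_X g; for (2), torsion-freeness `htor`
  -- plays the same role for dα.
  have hK1 := inner_leviCivita V.metric u v X.mdifferentiableAt (x := x)
  have hK2 := inner_leviCivita V.metric v u X.mdifferentiableAt (x := x)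
  have htor := leviCivita_sub_leviCivita V.metric u v x
  have hL : C.pairing x (e.1 x) (V.splitting x (VectorField.mlieBracket (𝓡 n) u v x)) =
      C.pairing x (e.1 x) (V.splitting x (leviCivita V.metric u v x))
        - C.pairing x (e.1 x) (V.splitting x (leviCivita V.metric v u x)) := by
    rw [← htor, map_sub, map_sub]
  have hs1 : VectorField.mlieBracket (𝓡 n) v u x = -VectorField.mlieBracket (𝓡 n) u v x := by
    rw [VectorField.mlieBracket_swap]; rfl
  have hs2 : VectorField.mlieBracket (𝓡 n) u X x = -VectorField.mlieBracket (𝓡 n) X u x := by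
    rw [VectorField.mlieBracket_swap]; rfl
  have hs3 : VectorField.mlieBracket (𝓡 n) v X x = -VectorField.mlieBracket (𝓡 n) X v x := by
    rw [VectorField.mlieBracket_swap]; rfl
  rw [V.pairing_bracket_liftSec_lowerLiftSec, hL, ← hX]
  simp only [hp, hm, hplus, hminus, symPart, altPart, Connection.extend, EndForm.dual, halpha, hrho,
    hadd, hsub, map_add, map_sub, _root_.add_apply, _root_.sub_apply, V.threeForm_swap X u v]
  have hXa : ∀ y, C.anchor y (e.1 y) = X y := fun _ => rfl
  simp only [koszul, hs1, hs2, hs3, map_neg, _root_.neg_apply, fun y => V.metric.symm y (v y) (u y),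
    fun y => V.metric.symm y (u y) (X y), fun y => V.metric.symm y (v y) (X y),
    V.metric.symm x (leviCivita V.metric _ _ x) (X x)] at hK1 hK2
  simp only [hXa]
  rw [V.metric.symm x (u x) (VectorField.mlieBracket (𝓡 n) X v x),
    V.metric.symm x (v x) (VectorField.mlieBracket (𝓡 n) X u x)]
  linarith

end SmallDirac

/-! ### Mixed brackets between V and V^⊥ -/

theorem pairing_bracket_skew (C : ExactCourantAlgebroid n F E) {a b : Sec n F E}
    (h : ∀ x, C.pairing x (a x) (b x) = 0) (c : Sec n F E) (x : M) :
    C.pairing x (C.bracket c a x) (b x) = -C.pairing x (C.bracket c b x) (a x) := by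
  have := C.lieDer_pairing c a b x
  rw [show (fun y => C.pairing y (a y) (b y)) = fun _ => 0 from funext h, lieDer_zero_fun,
    C.pairing_symm x (a x)] at this
  linarith

namespace GeneralizedMetric

variable (V : C.GeneralizedMetric)

theorem projSec_mem (z : Sec n F E) (x : M) : V.projSec z x ∈ V.fiber x := V.proj_mem x _

theorem coprojSec_mem (z : Sec n F E) (x : M) : V.coprojSec z x ∈ C.orth V.fiber x :=
  V.coproj_mem x _

theorem liftSec_mem (u : VF n M) (x : M) : V.liftSec u x ∈ V.fiber x := V.lift_mem x _

theorem lowerLiftSec_mem (u : VF n M) (x : M) : V.lowerLiftSec u x ∈ C.orth V.fiber x :=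
  V.lowerLift_mem x _

theorem liftSec_add (u v : VF n M) : V.liftSec (u + v) = V.liftSec u + V.liftSec v := by
  ext x; exact map_add (V.lift x) (u x) (v x)

theorem liftSec_smul (f : C^∞⟮𝓡 n, M; ℝ⟯) (u : VF n M) :
    V.liftSec (f • u) = f • V.liftSec u := by
  ext x; exact map_smul (V.lift x) (f x) (u x)

theorem lowerLiftSec_add (u v : VF n M) :
    V.lowerLiftSec (u + v) = V.lowerLiftSec u + V.lowerLiftSec v := by
  ext x; exact map_add (V.lowerLift x) (u x) (v x)

theorem lowerLiftSec_smul (f : C^∞⟮𝓡 n, M; ℝ⟯) (u : VF n M) :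
    V.lowerLiftSec (f • u) = f • V.lowerLiftSec u := by
  ext x; exact map_smul (V.lowerLift x) (f x) (u x)

/-- Split e = e₊ + e₋. Each half is orthogonal to one of a and b, so skewness of the bracket on
orthogonal sections and invariance of the pairing leave only brackets of the form [V^⊥, V] and [V,
V^⊥], the shapes that occur in the connections ∇±. -/
theorem pairing_bracket_eq (e : Sec n F E) {a b : Sec n F E} (ha : ∀ x, a x ∈ V.fiber x)
    (hb : ∀ x, b x ∈ C.orth V.fiber x) (x : M) :
    C.pairing x (C.bracket e a x) (b x) =
      C.pairing x (C.bracket b (V.projSec e) x) (a x)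
        - C.pairing x (C.bracket a (V.coprojSec e) x) (b x) := by
  have he : e = V.projSec e + V.coprojSec e := by
    ext x; exact (V.proj_add_coproj x (e x)).symm
  have h1 : C.bracket (V.coprojSec e) a = -C.bracket a (V.coprojSec e) :=
    V.bracket_swap_of_orth fun y => V.coprojSec_mem e y _ (ha y)
  have h2 : C.bracket (V.projSec e) b = -C.bracket b (V.projSec e) :=
    V.bracket_swap_of_orth fun y => V.pairing_eq_zero (V.projSec_mem e y) (hb y)
  have h3 := C.pairing_bracket_skew (fun y => V.pairing_eq_zero (ha y) (hb y)) (V.projSec e) x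
  rw [h2] at h3
  have h4 : C.bracket e a x = C.bracket (V.projSec e) a x + -C.bracket a (V.coprojSec e) x := by
    conv_lhs => rw [he]
    rw [map_add, LinearMap.add_apply, h1]
    rfl
  have h5 : (-C.bracket b (V.projSec e)) x = -C.bracket b (V.projSec e) x := rfl
  rw [h5] at h3
  rw [h4, map_add, _root_.add_apply, h3]
  simp only [map_neg, _root_.neg_apply]
  ring

end GeneralizedMetric

/-! ### The connections determined by V and D -/

namespace SmallDirac

variable (D : C.SmallDirac) (V : C.GeneralizedMetric)

/-- Both sides are the inner product on D of `riesz z` and `riesz w`; it is symmetric because `proj`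
is self-adjoint. -/
theorem pairing_riesz_comm (x : M) (z w : E x) :
    C.pairing x (D.riesz V x z) w = C.pairing x z (D.riesz V x w) := by
  rw [← D.pairing_proj_riesz V z (D.riesz_mem V x w), V.pairing_proj_comm, C.pairing_symm,
    ← D.pairing_proj_riesz V w (D.riesz_mem V x z), C.pairing_symm]

/-- The map `Γ(E) → Γ(D)` induced by `riesz`. -/
def rieszSec : Sec n F E →ₗ[C^∞⟮𝓡 n, M; ℝ⟯] D.Sections :=
  (mapSec n (D.riesz V) (D.smoothSecAt_riesz V)).codRestrict (secs n F D.fiber)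
    fun _ x => D.riesz_mem V x _

/-- The map `Γ(E) → Γ(D^⊥)` induced by `upperPerp`. -/
def upperPerpSec : Sec n F E →ₗ[C^∞⟮𝓡 n, M; ℝ⟯] Sec n F E :=
  mapSec n (D.upperPerp V) (D.smoothSecAt_upperPerp V)

/-- The map `Γ(E) → Γ(D^⊥)` induced by `lowerPerp`. -/
def lowerPerpSec : Sec n F E →ₗ[C^∞⟮𝓡 n, M; ℝ⟯] Sec n F E :=
  mapSec n (D.lowerPerp V) (D.smoothSecAt_lowerPerp V)

/-- The second factor is in V^⊥ ∩ D^⊥, so replacing e₋ by e changes nothing and gives 0. This makes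
[e₋, v'] skew, as the Leibniz rule for `connPlus` requires. -/
theorem pairing_coprojSec_lowerPerpSec (e : D.Sections) (v : VF n M) (x : M) :
    C.pairing x (V.coprojSec e.1 x) (D.lowerPerpSec V (V.lowerLiftSec v) x) = 0 := by
  have h1 : D.lowerPerpSec V (V.lowerLiftSec v) x ∈ C.orth D.fiber x :=
    D.lowerPerp_mem_orth V x _
  have h2 : D.lowerPerpSec V (V.lowerLiftSec v) x ∈ C.orth V.fiber x :=
    D.lowerPerp_mem V (V.lowerLiftSec_mem v x)
  change C.pairing x (V.coproj x (e.1 x)) _ = 0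
  rw [V.coproj_apply, map_sub, _root_.sub_apply, V.pairing_eq_zero (V.proj_mem x _) h2,
    C.pairing_symm, h1 _ (e.2 x), sub_zero]

theorem pairing_projSec_upperPerpSec (e : D.Sections) (u : VF n M) (x : M) :
    C.pairing x (V.projSec e.1 x) (D.upperPerpSec V (V.liftSec u) x) = 0 := by
  have h1 : D.upperPerpSec V (V.liftSec u) x ∈ C.orth D.fiber x := D.upperPerp_mem_orth V x _
  have h2 : D.upperPerpSec V (V.liftSec u) x ∈ V.fiber x :=
    D.upperPerp_mem V (V.liftSec_mem u x)
  change C.pairing x (V.proj x (e.1 x)) _ = 0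
  rw [V.pairing_proj_comm, V.proj_of_mem h2, C.pairing_symm, h1 _ (e.2 x)]

/-- The connection `∇⁺_v e = riesz ([v₋, e₊] - [e₋, v'])₊` on `D`, where `v'` is the component
of `v₋` in `D^⊥`. -/
def connPlus : D.Connection where
  toFun v e := D.rieszSec V (V.projSec (C.bracket (V.lowerLiftSec v) (V.projSec e.1)
    - C.bracket (V.coprojSec e.1) (D.lowerPerpSec V (V.lowerLiftSec v))))
  add_left u v e := by
    simp only [V.lowerLiftSec_add, map_add, LinearMap.add_apply, map_sub]
    abel
  smul_left f v e := by
    rw [V.lowerLiftSec_smul, map_smul (D.lowerPerpSec V), ← map_smul (D.rieszSec V),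
      ← map_smul V.projSec]
    refine congrArg (D.rieszSec V) (ContMDiffSection.ext fun x => ?_)
    change V.proj x (C.bracket (f • V.lowerLiftSec v) (V.projSec e.1) x
        - C.bracket (V.coprojSec e.1) (f • D.lowerPerpSec V (V.lowerLiftSec v)) x) =
      V.proj x (f x • (C.bracket (V.lowerLiftSec v) (V.projSec e.1) x
        - C.bracket (V.coprojSec e.1) (D.lowerPerpSec V (V.lowerLiftSec v)) x))
    -- The derivatives of f multiply v₋ and v', both in V^⊥, so the projection to V removes them.
    have h1 : V.proj x (V.lowerLiftSec v x) = 0 := V.proj_of_mem_orth (V.lowerLiftSec_mem v x)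
    have h2 : V.proj x (D.lowerPerpSec V (V.lowerLiftSec v) x) = 0 :=
      V.proj_of_mem_orth (D.lowerPerp_mem V (V.lowerLiftSec_mem v x))
    rw [V.bracket_smul_left_of_orth fun y => V.lowerLiftSec_mem v y _ (V.projSec_mem e.1 y),
      C.bracket_smul]
    simp only [map_sub, map_add, map_smul, h1, h2, smul_zero, sub_zero, add_zero, smul_sub]
  add_right v e e' := by
    change D.rieszSec V (V.projSec (C.bracket _ (V.projSec (e.1 + e'.1))
      - C.bracket (V.coprojSec (e.1 + e'.1)) _)) = _
    simp only [map_add, LinearMap.add_apply, map_sub]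
    abel
  leibniz f v e x := by
    refine Subtype.ext ?_
    change D.riesz V x (V.proj x (C.bracket (V.lowerLiftSec v) (V.projSec (f • e.1)) x
        - C.bracket (V.coprojSec (f • e.1)) (D.lowerPerpSec V (V.lowerLiftSec v)) x)) =
      f x • D.riesz V x (V.proj x (C.bracket (V.lowerLiftSec v) (V.projSec e.1) x
        - C.bracket (V.coprojSec e.1) (D.lowerPerpSec V (V.lowerLiftSec v)) x))
        + lieDer v f x • e.1 x
    -- Only [v₋, f e₊] contributes a derivative of f, namely v(f) e₊, which `riesz` returns to v(f)
    -- e. The derivative term of [f e₋, v'] is a multiple of e₋ and is projected away.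
    have h1 : V.proj x (V.coprojSec e.1 x) = 0 := V.proj_of_mem_orth (V.coproj_mem x _)
    have h2 : D.riesz V x (V.proj x (V.projSec e.1 x)) = e.1 x := by
      rw [V.proj_of_mem (V.projSec_mem e.1 x)]
      exact D.riesz_proj_of_mem V (e.2 x)
    have h3 : (fun y => C.anchor y (V.lowerLiftSec v y)) = v :=
      funext fun y => V.anchor_lowerLift y _
    rw [map_smul V.projSec, map_smul V.coprojSec, C.bracket_smul, V.bracket_smul_left_of_orth
      (D.pairing_coprojSec_lowerPerpSec V e v), h3]
    simp only [map_sub, map_add, map_smul, h1, h2, smul_zero, sub_zero, smul_sub]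
    abel

/-- The connection `∇⁻_u e = -riesz ([u₊, e₋] - [e₊, u'])₋` on `D`, where `u'` is the component
of `u₊` in `D^⊥`. -/
def connMinus : D.Connection where
  toFun u e := -D.rieszSec V (V.coprojSec (C.bracket (V.liftSec u) (V.coprojSec e.1)
    - C.bracket (V.projSec e.1) (D.upperPerpSec V (V.liftSec u))))
  add_left u v e := by
    simp only [V.liftSec_add, map_add, LinearMap.add_apply, map_sub]
    abel
  smul_left f v e := by
    rw [V.liftSec_smul, map_smul (D.upperPerpSec V), smul_neg, ← map_smul (D.rieszSec V),
      ← map_smul V.coprojSec]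
    refine congrArg (fun z => -D.rieszSec V z) (ContMDiffSection.ext fun x => ?_)
    change V.coproj x (C.bracket (f • V.liftSec v) (V.coprojSec e.1) x
        - C.bracket (V.projSec e.1) (f • D.upperPerpSec V (V.liftSec v)) x) =
      V.coproj x (f x • (C.bracket (V.liftSec v) (V.coprojSec e.1) x
        - C.bracket (V.projSec e.1) (D.upperPerpSec V (V.liftSec v)) x))
    have h1 : V.coproj x (V.liftSec v x) = 0 := V.coproj_of_mem (V.liftSec_mem v x)
    have h2 : V.coproj x (D.upperPerpSec V (V.liftSec v) x) = 0 :=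
      V.coproj_of_mem (D.upperPerp_mem V (V.liftSec_mem v x))
    rw [V.bracket_smul_left_of_orth fun y => V.pairing_eq_zero (V.liftSec_mem v y)
      (V.coprojSec_mem e.1 y), C.bracket_smul]
    simp only [map_sub, map_add, map_smul, h1, h2, smul_zero, sub_zero, add_zero, smul_sub]
  add_right v e e' := by
    change -D.rieszSec V (V.coprojSec (C.bracket _ (V.coprojSec (e.1 + e'.1))
      - C.bracket (V.projSec (e.1 + e'.1)) _)) = _
    simp only [map_add, LinearMap.add_apply, map_sub]
    abel
  leibniz f v e x := by
    refine Subtype.ext ?_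
    change -D.riesz V x (V.coproj x (C.bracket (V.liftSec v) (V.coprojSec (f • e.1)) x
        - C.bracket (V.projSec (f • e.1)) (D.upperPerpSec V (V.liftSec v)) x)) =
      f x • -D.riesz V x (V.coproj x (C.bracket (V.liftSec v) (V.coprojSec e.1) x
        - C.bracket (V.projSec e.1) (D.upperPerpSec V (V.liftSec v)) x))
        + lieDer v f x • e.1 x
    have h1 : V.coproj x (V.projSec e.1 x) = 0 := V.coproj_of_mem (V.proj_mem x _)
    -- This sign cancels the one in the definition of ∇⁻, so that the Leibniz term is +u(f) e.
    have h2 : D.riesz V x (V.coproj x (V.coprojSec e.1 x)) = -e.1 x := by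
      rw [V.coproj_of_mem_orth (V.coprojSec_mem e.1 x)]
      exact D.riesz_coproj_of_mem V (e.2 x)
    have h3 : (fun y => C.anchor y (V.liftSec v y)) = v := funext fun y => V.anchor_lift y _
    rw [map_smul V.coprojSec, map_smul V.projSec, C.bracket_smul, V.bracket_smul_left_of_orth
      (D.pairing_projSec_upperPerpSec V e v), h3]
    simp only [map_sub, map_add, map_smul, h1, h2, smul_zero, sub_zero, smul_sub, smul_neg,
      neg_sub]
    abel

theorem connPlus_apply (v : VF n M) (e : D.Sections) (x : M) :
    (D.connPlus V v e).1 x = D.riesz V x (V.proj x (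
      C.bracket (V.lowerLiftSec v) (V.projSec e.1) x
        - C.bracket (V.coprojSec e.1) (D.lowerPerpSec V (V.lowerLiftSec v)) x)) := rfl

theorem connMinus_apply (u : VF n M) (e : D.Sections) (x : M) :
    (D.connMinus V u e).1 x = -D.riesz V x (V.coproj x (
      C.bracket (V.liftSec u) (V.coprojSec e.1) x
        - C.bracket (V.projSec e.1) (D.upperPerpSec V (V.liftSec u)) x)) := rfl

/-- The tensor `⟨[e, u₊], v₋⟩ - ⟨∇⁺_v e, u₊⟩ + ⟨∇⁻_u e, v₋⟩` depends only on the components of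
`u₊` and `v₋` in `D^⊥`. -/
theorem pairing_bracket_sub_connPlus_add_connMinus (e : D.Sections) (u v : VF n M) (x : M) :
    C.pairing x (C.bracket e.1 (V.liftSec u) x) (V.lowerLiftSec v x)
        - C.pairing x ((D.connPlus V v e).1 x) (V.liftSec u x)
        + C.pairing x ((D.connMinus V u e).1 x) (V.lowerLiftSec v x) =
      C.pairing x (C.bracket e.1 (D.upperPerpSec V (V.liftSec u)) x)
        (D.lowerPerpSec V (V.lowerLiftSec v) x) := by
  set U := V.liftSec u with hU
  set W := V.lowerLiftSec v with hW
  set U' := D.upperPerpSec V U with hU'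
  set W' := D.lowerPerpSec V W with hW'
  set b := V.projSec (D.rieszSec V U).1 with hb
  set a := V.coprojSec (D.rieszSec V W).1 with ha
  set p := V.projSec e.1 with hp
  set q := V.coprojSec e.1 with hq
  have hUm : ∀ y, U y ∈ V.fiber y := V.liftSec_mem u
  have hWm : ∀ y, W y ∈ C.orth V.fiber y := V.lowerLiftSec_mem v
  have hUm' : ∀ y, U' y ∈ V.fiber y := fun y => D.upperPerp_mem V (hUm y)
  have hWm' : ∀ y, W' y ∈ C.orth V.fiber y := fun y => D.lowerPerp_mem V (hWm y)
  have hbm : ∀ y, b y ∈ V.fiber y := V.projSec_mem _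
  have ham : ∀ y, a y ∈ C.orth V.fiber y := V.coprojSec_mem _
  have hpm : ∀ y, p y ∈ V.fiber y := V.projSec_mem _
  have hqm : ∀ y, q y ∈ C.orth V.fiber y := V.coprojSec_mem _
  -- Here u₊ = u' + b and v₋ = v' - a, with u', v' in D^⊥. After expansion, the first brackets in ∇±
  -- absorb the terms paired with a or b, and the correction brackets [e₋, v'] and [e₊, u'] cancel
  -- the remaining cross terms through `h3` and `h4`.
  have hUs : U = U' + b := by ext y; exact (sub_add_cancel (U y) (b y)).symm
  have hWs : W = W' - a := by ext y; exact (add_sub_cancel_right (W y) (a y)).symm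
  have hplus : C.pairing x ((D.connPlus V v e).1 x) (U x) =
      C.pairing x (C.bracket W p x) (b x) - C.pairing x (C.bracket q W' x) (b x) := by
    rw [connPlus_apply, D.pairing_riesz_comm, V.pairing_proj_comm, map_sub, _root_.sub_apply]
    rfl
  have hminus : C.pairing x ((D.connMinus V u e).1 x) (W x) =
      -C.pairing x (C.bracket U q x) (a x) + C.pairing x (C.bracket p U' x) (a x) := by
    have h : ∀ z : E x, C.pairing x (V.coproj x z) (D.riesz V x (W x)) =
        C.pairing x z (a x) := fun z => by
      rw [V.pairing_coproj_left, C.pairing_symm, ← V.pairing_coproj_left, C.pairing_symm]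
      rfl
    rw [connMinus_apply, map_neg, _root_.neg_apply, D.pairing_riesz_comm, h, map_sub,
      _root_.sub_apply]
    ring
  have h1 := V.pairing_bracket_eq e.1 hUm hWm x
  have h2 := V.pairing_bracket_eq e.1 hUm' hWm' x
  have hap : C.bracket a p = -C.bracket p a :=
    V.bracket_swap_of_orth fun y => ham y _ (hpm y)
  have hbq : C.bracket b q = -C.bracket q b :=
    V.bracket_swap_of_orth fun y => V.pairing_eq_zero (hbm y) (hqm y)
  have h3 := C.pairing_bracket_skew (fun y => ham y _ (hUm' y)) p x
  have h4 := C.pairing_bracket_skew (fun y => V.pairing_eq_zero (hbm y) (hWm' y)) q x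
  have h5 : C.bracket W p x = C.bracket W' p x + C.bracket p a x := by
    rw [hWs, map_sub, LinearMap.sub_apply, hap, sub_neg_eq_add]
    rfl
  have h6 : C.bracket U q x = C.bracket U' q x - C.bracket q b x := by
    rw [hUs, map_add, LinearMap.add_apply, hbq, ← sub_eq_add_neg]
    rfl
  have h7 : U x = U' x + b x := by rw [hUs]; rfl
  have h8 : W x = W' x - a x := by rw [hWs]; rfl
  rw [hplus, hminus, h1, h2, h5, h6, h7, h8]
  simp only [map_add, map_sub, _root_.add_apply, _root_.sub_apply]
  linarith

end SmallDirac

/-! ### Means and differences of connections; two facts on projections -/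

namespace SmallDirac

variable {D : C.SmallDirac}

theorem sections_smul_add_smul_half (d d' : D.Sections) :
    (algebraMap ℝ C^∞⟮𝓡 n, M; ℝ⟯ (1 / 2)) • (d + d')
      + (algebraMap ℝ C^∞⟮𝓡 n, M; ℝ⟯ (1 / 2)) • (d - d') = d := by
  rw [← smul_add, add_add_sub_cancel, smul_add, ← add_smul, ← map_add, add_halves, map_one,
    one_smul]

theorem sections_smul_sub_smul_half (d d' : D.Sections) :
    (algebraMap ℝ C^∞⟮𝓡 n, M; ℝ⟯ (1 / 2)) • (d + d')
      - (algebraMap ℝ C^∞⟮𝓡 n, M; ℝ⟯ (1 / 2)) • (d - d') = d' := by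
  refine Subtype.ext (ContMDiffSection.ext fun x => ?_)
  change (1 / 2 : ℝ) • (d.1 x + d'.1 x) - (1 / 2 : ℝ) • (d.1 x - d'.1 x) = d'.1 x
  module

/-- The derivative terms of the two Leibniz rules coincide; hence half the difference is an
End(D)-valued 1-form. -/
theorem Connection.map_smul_sub (nabla nabla' : D.Connection) (f : C^∞⟮𝓡 n, M; ℝ⟯) (X : VF n M)
    (e : D.Sections) :
    nabla X (f • e) - nabla' X (f • e) = f • (nabla X e - nabla' X e) := by
  refine Subtype.ext (ContMDiffSection.ext fun x => ?_)
  have h1 := congrArg Subtype.val (nabla.leibniz f X e x)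
  have h2 := congrArg Subtype.val (nabla'.leibniz f X e x)
  change (nabla X (f • e)).1 x = f x • (nabla X e).1 x + lieDer X f x • e.1 x at h1
  change (nabla' X (f • e)).1 x = f x • (nabla' X e).1 x + lieDer X f x • e.1 x at h2
  change (nabla X (f • e)).1 x - (nabla' X (f • e)).1 x
    = f x • ((nabla X e).1 x - (nabla' X e).1 x)
  rw [h1, h2, smul_sub, add_sub_add_right_eq_sub]

/-- The mean `(∇ + ∇') / 2` of two connections. -/
def Connection.mean (nabla nabla' : D.Connection) : D.Connection where
  toFun X e := (algebraMap ℝ C^∞⟮𝓡 n, M; ℝ⟯ (1 / 2)) • (nabla X e + nabla' X e)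
  add_left X Y e := by
    rw [nabla.add_left, nabla'.add_left, ← smul_add]
    congr 1
    abel
  smul_left f X e := by
    rw [nabla.smul_left, nabla'.smul_left, ← smul_add, smul_comm]
  add_right X e e' := by
    rw [nabla.add_right, nabla'.add_right, ← smul_add]
    congr 1
    abel
  leibniz f X e x := by
    refine Subtype.ext ?_
    have h1 := congrArg Subtype.val (nabla.leibniz f X e x)
    have h2 := congrArg Subtype.val (nabla'.leibniz f X e x)
    change (nabla X (f • e)).1 x = f x • (nabla X e).1 x + lieDer X f x • e.1 x at h1
    change (nabla' X (f • e)).1 x = f x • (nabla' X e).1 x + lieDer X f x • e.1 x at h2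
    change (1 / 2 : ℝ) • ((nabla X (f • e)).1 x + (nabla' X (f • e)).1 x) =
      f x • (1 / 2 : ℝ) • ((nabla X e).1 x + (nabla' X e).1 x) + lieDer X f x • e.1 x
    rw [h1, h2]
    module

/-- Half the difference `(∇ - ∇') / 2` of two connections. -/
def Connection.halfDiff (nabla nabla' : D.Connection) : D.EndForm :=
  LinearMap.mk₂ C^∞⟮𝓡 n, M; ℝ⟯
    (fun X e => (algebraMap ℝ C^∞⟮𝓡 n, M; ℝ⟯ (1 / 2)) • (nabla X e - nabla' X e))
    (fun X Y e => by
      rw [nabla.add_left, nabla'.add_left, ← smul_add]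
      congr 1
      abel)
    (fun f X e => by
      rw [nabla.smul_left, nabla'.smul_left]
      refine Subtype.ext (ContMDiffSection.ext fun x => ?_)
      change (1 / 2 : ℝ) • (f x • (nabla X e).1 x - f x • (nabla' X e).1 x) =
        f x • (1 / 2 : ℝ) • ((nabla X e).1 x - (nabla' X e).1 x)
      module)
    (fun X e e' => by
      rw [nabla.add_right, nabla'.add_right, ← smul_add]
      congr 1
      abel)
    (fun f X e => by
      rw [nabla.map_smul_sub nabla', smul_comm])

variable {V : C.GeneralizedMetric}

theorem sub_riesz_proj_mem {x : M} {w : E x} (hw : w ∈ transverseOf V D x) :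
    w - D.riesz V x (V.proj x w) ∈ C.orth D.fiber x ⊓ V.fiber x := by
  obtain ⟨d, hd, y, hy, rfl⟩ := Submodule.mem_sup.1 hw
  rw [map_add, map_add, D.riesz_proj_of_mem V hd, V.proj_of_mem hy.2,
    (D.riesz_eq_zero_iff V).2 hy.1, add_zero, add_sub_cancel_left]
  exact hy

/-- With c = lowerPerp z₋ ∈ V^⊥ ∩ D^⊥, c differs from z by elements of V and of D, both orthogonal
to c. It turns ⟨z, c⟩ = 0 into c = 0, by negative definiteness. -/
theorem pairing_lowerPerp_coproj {x : M} (z : E x) :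
    C.pairing x (D.lowerPerp V x (V.coproj x z)) (D.lowerPerp V x (V.coproj x z)) =
      C.pairing x z (D.lowerPerp V x (V.coproj x z)) := by
  have hD := D.lowerPerp_mem_orth V x (V.coproj x z)
  have hV := D.lowerPerp_mem V (V.coproj_mem x z)
  have h : ∀ y : E x, C.pairing x (V.coproj x y) (D.lowerPerp V x (V.coproj x z)) =
      C.pairing x y (D.lowerPerp V x (V.coproj x z)) := fun y => by
    rw [V.coproj_apply, map_sub, _root_.sub_apply, V.pairing_eq_zero (V.proj_mem x y) hV, sub_zero]
  calc _ = C.pairing x (V.coproj x z + V.coproj x (D.riesz V x (V.coproj x z)))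
        (D.lowerPerp V x (V.coproj x z)) := rfl
    _ = _ := by
      rw [map_add (C.pairing x), _root_.add_apply, h, h, C.pairing_symm x (D.riesz V x _),
        hD _ (D.riesz_mem V x _), add_zero]

end SmallDirac

/-! ### The bracket criterion and the two implications -/

variable {V : C.GeneralizedMetric} {D : C.SmallDirac}

/-- `(E, V, D)` is a Dirac-Riemannian foliation iff the brackets of sections of `D` and
`D^⊥ ∩ V` are orthogonal to `D^⊥ ∩ V^⊥`. -/
theorem isDiracRiemannianFoliation_iff : IsDiracRiemannianFoliation V D ↔
    ∀ (e : D.Sections) (a b : Sec n F E), (∀ x, a x ∈ V.fiber x) →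
      (∀ x, a x ∈ C.orth D.fiber x) → (∀ x, b x ∈ C.orth V.fiber x) →
      (∀ x, b x ∈ C.orth D.fiber x) → ∀ x, C.pairing x (C.bracket e.1 a x) (b x) = 0 := by
  refine ⟨fun h e a b haV haD hbV hbD x => ?_, fun h => ⟨D.isSubbundle_transverseOf V,
    D.finrank_transverseOf V, fun x => le_sup_left, D.transverseOf_le_orth V,
    fun x w hw hwD => D.pos_of_mem_transverseOf V hw hwD, fun e he w hw => ?_⟩⟩
  · have haW : a ∈ secs n F (transverseOf V D) := fun y =>
      Submodule.mem_sup_right ⟨haD y, haV y⟩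
    exact D.pairing_eq_zero_of_mem_transverseOf V (h.invariant e.1 e.2 a haW x) (hbD x) (hbV x)
  · set d := D.rieszSec V (V.projSec w) with hd
    set y : Sec n F E := w - d.1 with hy
    have hwy : w = d.1 + y := by rw [hy]; abel
    have hym : ∀ x, y x ∈ C.orth D.fiber x ⊓ V.fiber x := fun x =>
      SmallDirac.sub_riesz_proj_mem (hw x)
    have hbr : C.bracket e y ∈ secs n F (transverseOf V D) := by
      set z := C.bracket e y with hz
      -- Invariance of the pairing moves the bracket to [e, b] with b in Γ(D), which is again in D
      -- and so orthogonal to `y`. The single section b = riesz z suffices as a test, as its inner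
      -- product with itself is ⟨z, b⟩.
      have hzD : ∀ x, z x ∈ C.orth D.fiber x := fun x => by
        rw [← D.riesz_eq_zero_iff V]
        set b := D.rieszSec V z with hb
        refine D.eq_zero_of_mem_inf V (D.riesz_mem V x (z x)) ?_
        rw [D.pairing_proj_riesz V (z x) (D.riesz_mem V x (z x))]
        have h1 := C.pairing_bracket_skew (a := y) (b := b.1)
          (fun x => (hym x).1 _ (b.2 x)) e x
        have h2 := (hym x).1 _ (D.involutive e he b.1 b.2 x)
        rw [C.pairing_symm] at h2
        rw [h2, neg_zero] at h1
        exact h1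
      intro x
      refine D.mem_transverseOf V (hzD x) ?_
      -- The obstruction to z ∈ V_D is itself a section of V^⊥ ∩ D^⊥, so the hypothesis can be
      -- tested on it.
      set c := D.lowerPerpSec V (V.coprojSec z) with hc
      have hcV : ∀ x, c x ∈ C.orth V.fiber x := fun x => D.lowerPerp_mem V (V.coproj_mem x _)
      have h0 := h ⟨e, he⟩ y c (fun x => (hym x).2) (fun x => (hym x).1) hcV
        (fun x => D.lowerPerp_mem_orth V x _) x
      by_contra hne
      refine (V.pairing_self_neg (hcV x) hne).ne ?_
      exact (SmallDirac.pairing_lowerPerp_coproj (D := D) (V := V) (z x)).trans h0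
    rw [hwy, map_add]
    exact Submodule.add_mem _ (fun x => Submodule.mem_sup_left (D.involutive e he d.1 d.2 x)) hbr

/-- Take u = ρ(a) and v = ρ(b), so that u₊ = a and v₋ = b: the connection terms of T pair D with D^⊥
and drop out. -/
theorem isDiracRiemannianFoliation_of_compatible (nablaPlus nablaMinus nabla : D.Connection)
    (φ : D.EndForm) (hp : ∀ X e, nablaPlus X e = nabla X e + φ X e)
    (hm : ∀ X e, nablaMinus X e = nabla X e - φ X e) (hsym : SymCompatible V D nabla φ)
    (halt : AltCompatible V D nabla φ) : IsDiracRiemannianFoliation V D := by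
  refine isDiracRiemannianFoliation_iff.2 fun e a b haV haD hbV hbD x => ?_
  have h := SmallDirac.pairing_bracket_sub_eq_symPart_sub_altPart (V := V) nablaPlus nablaMinus
    nabla φ hp hm e (C.anchorSec a) (C.anchorSec b) x
  have ha : V.liftSec (C.anchorSec a) = a := ContMDiffSection.ext fun y => V.lift_anchor (haV y)
  have hb : V.lowerLiftSec (C.anchorSec b) = b :=
    ContMDiffSection.ext fun y => V.lowerLift_anchor (hbV y)
  rw [ha, hb, hsym, halt, C.pairing_symm x _ (a x), haD x _ ((nablaPlus _ e).2 x),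
    C.pairing_symm x ((nablaMinus _ e).1 x), hbD x _ ((nablaMinus _ e).2 x)] at h
  linarith

theorem IsDiracRiemannianFoliation.exists_compatible (h : IsDiracRiemannianFoliation V D) :
    ∃ (nablaPlus nablaMinus nabla : D.Connection) (φ : D.EndForm),
      (∀ X e, nablaPlus X e = nabla X e + φ X e) ∧ (∀ X e, nablaMinus X e = nabla X e - φ X e) ∧
      SymCompatible V D nabla φ ∧ AltCompatible V D nabla φ := by
  set nablaPlus := D.connPlus V
  set nablaMinus := D.connMinus V
  set nabla := nablaPlus.mean nablaMinus
  set φ := nablaPlus.halfDiff nablaMinus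
  have hp : ∀ X e, nablaPlus X e = nabla X e + φ X e := fun X e =>
    (SmallDirac.sections_smul_add_smul_half (nablaPlus X e) (nablaMinus X e)).symm
  have hm : ∀ X e, nablaMinus X e = nabla X e - φ X e := fun X e =>
    (SmallDirac.sections_smul_sub_smul_half (nablaPlus X e) (nablaMinus X e)).symm
  have hzero : ∀ (e : D.Sections) (u v : VF n M) (x : M),
      symPart (fun u v x => nabla.extend V.metric (D.rhoBar V) e u v x
        - SmallDirac.EndForm.dual φ (D.alpha V) e u v x) u v x =
      altPart (fun u v x => nabla.extend V.metric (D.alpha V) e u v x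
        - SmallDirac.EndForm.dual φ (D.rhoBar V) e u v x
        - (1 / 2) * V.threeForm (C.anchorSec e.1) u v x) u v x := fun e u v x => by
    have h1 := SmallDirac.pairing_bracket_sub_eq_symPart_sub_altPart (V := V) nablaPlus nablaMinus
      nabla φ hp hm e u v x
    rw [D.pairing_bracket_sub_connPlus_add_connMinus V e u v x,
      isDiracRiemannianFoliation_iff.1 h e _ _ (fun y => D.upperPerp_mem V (V.liftSec_mem u y))
        (fun y => D.upperPerp_mem_orth V y _) (fun y => D.lowerPerp_mem V (V.lowerLiftSec_mem v y))
        (fun y => D.lowerPerp_mem_orth V y _)] at h1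
    linarith
  refine ⟨nablaPlus, nablaMinus, nabla, φ, hp, hm, fun e u v x => ?_, fun e u v x => ?_⟩ <;>
  -- T = 0 equates a symmetric and an antisymmetric expression in (u, v); comparing with (v, u)
  -- makes both vanish.
  · have h1 := hzero e u v x
    have h2 := hzero e v u x
    simp only [symPart, altPart] at h1 h2 ⊢
    linarith

end ExactCourantAlgebroid

end

end DiracRiemann

theorem mainTheorem1 {n : ℕ} {M : Type*} [TopologicalSpace M] [T2Space M] [SigmaCompactSpace M]
    [ChartedSpace (EuclideanSpace ℝ (Fin n)) M] [IsManifold (𝓡 n) ∞ M]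
    {F : Type*} [NormedAddCommGroup F] [NormedSpace ℝ F] [FiniteDimensional ℝ F]
    {E : M → Type*} [∀ x, AddCommGroup (E x)] [∀ x, Module ℝ (E x)]
    [∀ x, TopologicalSpace (E x)] [∀ x, IsTopologicalAddGroup (E x)]
    [∀ x, ContinuousSMul ℝ (E x)] [TopologicalSpace (TotalSpace F E)] [FiberBundle F E]
    [VectorBundle ℝ F E] [ContMDiffVectorBundle ∞ F E (𝓡 n)]
    (C : DiracRiemann.ExactCourantAlgebroid n F E) (V : C.GeneralizedMetric) (D : C.SmallDirac) :
    DiracRiemann.ExactCourantAlgebroid.IsDiracRiemannianFoliation V D ↔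
      ∃ (nablaPlus nablaMinus nabla : D.Connection) (φ : D.EndForm),
        (∀ X e, nablaPlus X e = nabla X e + φ X e) ∧
        (∀ X e, nablaMinus X e = nabla X e - φ X e) ∧
        DiracRiemann.ExactCourantAlgebroid.SymCompatible V D nabla φ ∧
        DiracRiemann.ExactCourantAlgebroid.AltCompatible V D nabla φ :=
  ⟨fun h => h.exists_compatible, fun ⟨nablaPlus, nablaMinus, nabla, φ, hp, hm, hsym, halt⟩ =>
    DiracRiemann.ExactCourantAlgebroid.isDiracRiemannianFoliation_of_compatible nablaPlus nablaMinus
      nabla φ hp hm hsym halt⟩
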